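/- Let $\sigma\ge 2$, let $p_1,\dots,p_\sigma>0$ be probabilities with $\sum_i p_i=1$, and let $c$ be an optimal binary prefix code for them, i.e. a prefix-free assignment of binary codewords to the characters $1,\dots,\sigma$ that minimizes the expected codeword length among all prefix-free codes for these characters. Suppose that the lengths of the codewords are non-decreasing when the codewords are arranged so that their reverses are in lexicographic order. Let $L$ be the maximum codeword length. Then, possibly after permuting codewords of the same length among the characters, the code can be stored in $O(\sigma\log L)$ bits so that any character can be encoded, and any character can be decoded from a bit stream that starts with its codeword, in $O(\ell)$ time, where $\ell$ is the length of its codeword. (For $L=1$, $\log L$ is read as $1$.) The model is the unit-cost word RAM with words of $w=\Omega(\log\sigma)$ bits: there are a fixed encoding program, a fixed decoding program and absolute constants $C,C',\kappa$ such that, for all $\sigma,p,c$ as above, there is a permutation $\pi$ of the characters with $|c(\pi(i))|=|c(i)|$ for all $i$ such that, for every $w\ge\kappa\log_2\sigma$, there is a bit string of length at most $C\,\sigma\log_2\max(L,2)$ for which the following holds. With this bit string in read-only memory, packed into $w$-bit words, the encoding program, given any character $i$, outputs exactly the codeword $c(\pi(i))$, and the decoding program, given any bit stream that starts with $c(\pi(i))$,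 consumes exactly that codeword and returns $i$, each in at most $C'\,|c(\pi(i))|$ steps. -/

import Mathlib

/-! ### Binary prefix codes -/

/-- A prefix(-free) binary code for the characters `0, …, σ - 1`: no codeword is a prefix of the
codeword of another character (in particular the codewords are distinct). -/
def IsPrefixCode {σ : ℕ} (c : Fin σ → List Bool) : Prop :=
  ∀ i j : Fin σ, c i <+: c j → i = j

/-- Expected codeword length of `c` under the character probabilities `p`. -/
def expectedLength {σ : ℕ} (p : Fin σ → ℝ) (c : Fin σ → List Bool) : ℝ :=
  ∑ i, p i * ((c i).length : ℝ)

/-- `c` is an optimal prefix code for `p`: no prefix code for the same characters has a smaller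
expected codeword length. -/
def IsOptimalPrefixCode {σ : ℕ} (p : Fin σ → ℝ) (c : Fin σ → List Bool) : Prop :=
  IsPrefixCode c ∧ ∀ c' : Fin σ → List Bool, IsPrefixCode c' →
    expectedLength p c ≤ expectedLength p c'

/-- The codewords' lengths are non-decreasing when the codewords are arranged so that their
reverses are in lexicographic order (`<` on `List Bool` is lexicographic, with `false < true` and
a proper prefix smaller than its extensions). -/
def LengthsMonotoneInReverseLex {σ : ℕ} (c : Fin σ → List Bool) : Prop :=
  ∀ i j : Fin σ, (c i).reverse < (c j).reverse → (c i).length ≤ (c j).length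

/-- The maximum codeword length. -/
def maxCodewordLength {σ : ℕ} (c : Fin σ → List Bool) : ℕ :=
  Finset.univ.sup fun i => (c i).length

/-! ### The word RAM

A unit-cost RAM with `w`-bit words (natural numbers below `2 ^ w`). It has registers, a writable
work memory of words that is initially zero, and a read-only data memory which holds a bit string
packed into words. It reads a stream of input bits and writes a stream of output bits, one bit per
instruction. Programs are structured programs over these instructions; a program mentions only
finitely many registers and does not depend on `w`, on the data or on the input. -/

namespace WordRAM

/-- Operations on words. -/
inductive BinOp where
  | add | sub | mul | div | mod | and | or | xor | shl | shr | lt | eq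

/-- The value of an operation on `w`-bit words. Arithmetic is modulo `2 ^ w`, shifts are logical,
and comparisons give `1` for true and `0` for false. -/
def BinOp.eval (w : ℕ) : BinOp → ℕ → ℕ → ℕ
  | .add, a, b => (a + b) % 2 ^ w
  | .sub, a, b => (a + (2 ^ w - b)) % 2 ^ w
  | .mul, a, b => (a * b) % 2 ^ w
  | .div, a, b => a / b
  | .mod, a, b => a % b
  | .and, a, b => a &&& b
  | .or, a, b => a ||| b
  | .xor, a, b => a ^^^ b
  | .shl, a, b => (a * 2 ^ b) % 2 ^ w
  | .shr, a, b => a / 2 ^ b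
  | .lt, a, b => if a < b then 1 else 0
  | .eq, a, b => if a = b then 1 else 0

/-- Instructions; each takes one unit of time. Arguments of type `ℕ` are register numbers,
except for the literal `n` of `const`. -/
inductive Instr where
  /-- `r := n` -/
  | const (r n : ℕ)
  /-- `r := w`, the word length of the machine -/
  | wordSize (r : ℕ)
  /-- `r := a op b` -/
  | op (o : BinOp) (r a b : ℕ)
  /-- `r :=` the work memory word whose address is in `a` -/
  | load (r a : ℕ)
  /-- the work memory word whose address is in `a` becomes `r` -/
  | store (a r : ℕ)
  /-- `r :=` the data memory word whose address is in `a` -/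
  | loadData (r a : ℕ)
  /-- `r :=` the next input bit, which is consumed -/
  | readBit (r : ℕ)
  /-- appends a bit to the output: `0` if `r` is `0`, and `1` otherwise -/
  | writeBit (r : ℕ)

/-- Structured programs: single instructions, sequencing, branching and looping while a register
is non-zero. -/
inductive Prog where
  | nop
  | instr (a : Instr)
  | seq (P Q : Prog)
  | branch (r : ℕ) (P Q : Prog)
  | loop (r : ℕ) (P : Prog)

/-- The mutable part of a configuration. -/
structure State where
  reg : ℕ → ℕ
  work : ℕ → ℕ
  input : List Bool
  output : List Bool

/-- The number with the given binary digits, least significant digit first. -/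
def bitsToNat : List Bool → ℕ
  | [] => 0
  | b :: bs => b.toNat + 2 * bitsToNat bs

/-- The word at address `a` of the data memory that holds the bit string `data`: it consists of the
bits `a * w, …, a * w + w - 1` of `data` (bits beyond the end are `0`). -/
def dataWord (w : ℕ) (data : List Bool) (a : ℕ) : ℕ :=
  bitsToNat ((data.drop (a * w)).take w)

/-- The state with register `r` set to `v`. -/
def State.setReg (s : State) (r v : ℕ) : State :=
  { s with reg := Function.update s.reg r v }

/-- The effect of one instruction. -/
def Instr.exec (w : ℕ) (data : List Bool) : Instr → State → State
  | .const r n, s => s.setReg r (n % 2 ^ w)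
  | .wordSize r, s => s.setReg r w
  | .op o r a b, s => s.setReg r (o.eval w (s.reg a) (s.reg b))
  | .load r a, s => s.setReg r (s.work (s.reg a))
  | .store a r, s => { s with work := Function.update s.work (s.reg a) (s.reg r) }
  | .loadData r a, s => s.setReg r (dataWord w data (s.reg a))
  | .readBit r, s =>
      { s with reg := Function.update s.reg r (s.input.headD false).toNat, input := s.input.tail }
  | .writeBit r, s => { s with output := s.output ++ [decide (s.reg r ≠ 0)] }

/-- `Exec w data P s t s'`: on the machine with word length `w` and data memory `data`, the program
`P` started in state `s` halts in state `s'` after `t` units of time. Every instruction and every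
test of a branch or of a loop takes one unit. -/
inductive Exec (w : ℕ) (data : List Bool) : Prog → State → ℕ → State → Prop where
  | nop (s : State) : Exec w data .nop s 0 s
  | instr (a : Instr) (s : State) : Exec w data (.instr a) s 1 (a.exec w data s)
  | seq {P Q : Prog} {s s' s'' : State} {t t' : ℕ} :
      Exec w data P s t s' → Exec w data Q s' t' s'' → Exec w data (.seq P Q) s (t + t') s''
  | branchTrue {r : ℕ} {P Q : Prog} {s s' : State} {t : ℕ} :
      s.reg r ≠ 0 → Exec w data P s t s' → Exec w data (.branch r P Q) s (t + 1) s'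
  | branchFalse {r : ℕ} {P Q : Prog} {s s' : State} {t : ℕ} :
      s.reg r = 0 → Exec w data Q s t s' → Exec w data (.branch r P Q) s (t + 1) s'
  | loopTrue {r : ℕ} {P : Prog} {s s' s'' : State} {t t' : ℕ} :
      s.reg r ≠ 0 → Exec w data P s t s' → Exec w data (.loop r P) s' t' s'' →
        Exec w data (.loop r P) s (t + t' + 1) s''
  | loopFalse {r : ℕ} {P : Prog} {s : State} :
      s.reg r = 0 → Exec w data (.loop r P) s 1 s

/-- The initial state with argument `x` in register `0` and with the given input stream; the other
registers and the work memory are zero, and the output is empty. -/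
def initialState (x : ℕ) (input : List Bool) : State where
  reg := Function.update (fun _ => 0) 0 x
  work := fun _ => 0
  input := input
  output := []

/-- Given the character `x` in register `0`, the program `P` writes exactly the codeword `u` to the
output and halts, within time `T`. -/
def EncodesWithin (w : ℕ) (data : List Bool) (P : Prog) (x : ℕ) (u : List Bool) (T : ℕ) : Prop :=
  ∃ (t : ℕ) (s : State), Exec w data P (initialState x []) t s ∧ s.output = u ∧ t ≤ T

/-- On every input stream that starts with the codeword `u`, the program `P` consumes exactly `u`
and halts with the character `x` in register `0`, within time `T`. -/
def DecodesWithin (w : ℕ) (data : List Bool) (P : Prog) (x : ℕ) (u : List Bool) (T : ℕ) : Prop :=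
  ∀ rest : List Bool, ∃ (t : ℕ) (s : State),
    Exec w data P (initialState 0 (u ++ rest)) t s ∧ s.reg 0 = x ∧ s.input = rest ∧ t ≤ T

end WordRAM

/-! ### Optimal prefix codes are complete -/

/-! Positive probabilities make an optimal code complete: a node with one child could be contracted
(`IsOptimalPrefixCode.exists_comparable`). So the code tree is full, and its depth `L` satisfies `L
≤ σ ≤ 2 ^ L`.

Order the nodes of each level by their reverses. Appending a bit to a node puts that bit first in
the reverse, so on level `d + 1` all `0`-children precede all `1`-children, and each half keeps the
order of the parents (`nodeIndex_child`). Monotonicity of the lengths forces the leaves of a level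
to precede its internal nodes (`leaf_lt_internal`). Hence a node is determined by its level and its
number `x`, and following the bit `b` means `x (d + 1) = x d - leaves d + b * internal d`, where `x
d < leaves d` tests for a leaf. The shape of the tree is thus navigable in both directions from two
numbers per level. That takes `O(L log σ)` bits, which is `O(σ log L)` by `mul_size_le`.

It remains to match leaves with characters. Permuting codewords of equal length (`exists_perm`), the
leaves listed level by level become the characters sorted by the key `length * σ + character`. The
decoder walks down and reads the key at the position of the leaf. The encoder reads the length `ℓ`
of the codeword from an array with `O(log L)` bits per character, finds the key by binary search
among at most `2 ^ ℓ` leaves, and walks up. Each of these takes `O(ℓ)` steps.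

Written out, the sorted keys would take `σ log σ` bits. They are cut into groups of `Θ(log σ)` keys,
stored relative to the first key of the group with `O(log L)` bits each if the group spans a short
range, and with `O(log σ)` bits each otherwise. The keys increase by at most `(L + 1) * σ`
altogether, so groups with a long range are rare (`sum_groupWidth_le`). The rest is the verification
of the programs (`encoder_spec`, `decoder_spec`) and of the memory layout (`TableData.storedIn`). -/

theorem IsPrefixCode.injective {σ : ℕ} {c : Fin σ → List Bool} (hc : IsPrefixCode c) :
    Function.Injective c := fun i j h => hc i j (h ▸ List.prefix_rfl)

/-- Every word is comparable with a codeword of an optimal prefix code. -/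
theorem IsOptimalPrefixCode.exists_comparable {σ : ℕ} {p : Fin σ → ℝ} {c : Fin σ → List Bool}
    (hσ : 0 < σ) (hp : ∀ i, 0 < p i) (hc : IsOptimalPrefixCode p c) (u : List Bool) :
    ∃ i, c i <+: u ∨ u <+: c i := by
  induction u using List.reverseRecOn with
  | nil => exact ⟨⟨0, hσ⟩, Or.inr List.nil_prefix⟩
  | append_singleton s b ih =>
    by_contra! hno
    have hext : ∀ j, s <+: c j → s ++ [!b] <+: c j := by
      rintro j ⟨t, ht⟩
      match t with
      | [] =>
        refine absurd ?_ (hno j).1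
        rw [← ht, List.append_nil]
        exact List.prefix_append _ _
      | b' :: t' =>
        by_cases hb : b' = b
        · refine absurd ?_ (hno j).2
          rw [← ht, hb]
          exact ⟨t', by simp⟩
        · have : b' = !b := by cases b <;> cases b' <;> simp_all
          rw [← ht, this]
          exact ⟨t', by simp⟩
    have hns : ∀ j, ¬ c j <+: s := fun j h => (hno j).1 (h.trans (List.prefix_append _ _))
    obtain ⟨i, hi⟩ := ih
    have hi : s <+: c i := hi.resolve_left (hns i)
    -- The node `s` has only the child `s ++ [!b]`, so the bit after `s` carries no information.
    -- Deleting it from all codewords through `s` keeps the code prefix-free and lowers the cost,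
    -- since some codeword passes through `s` and has positive probability.
    let c' : Fin σ → List Bool := fun j =>
      if s ++ [!b] <+: c j then s ++ (c j).drop (s.length + 1) else c j
    have hpos : ∀ j, s ++ [!b] <+: c j → ∃ t, c j = s ++ (!b) :: t ∧ c' j = s ++ t := by
      rintro j ⟨t, ht⟩
      refine ⟨t, by simp [← ht], ?_⟩
      have h1 : s ++ [!b] <+: c j := ⟨t, ht⟩
      have h2 : (c j).drop (s.length + 1) = t := by
        rw [← ht, List.drop_left' (by simp)]
      simp only [c', if_pos h1, h2]
    have hneg : ∀ j, ¬ s ++ [!b] <+: c j → c' j = c j := fun j h => if_neg h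
    have hpre : IsPrefixCode c' := by
      intro j k hjk
      apply hc.1
      by_cases hj : s ++ [!b] <+: c j <;> by_cases hk : s ++ [!b] <+: c k
      · obtain ⟨t, h1, h2⟩ := hpos j hj
        obtain ⟨t', h1', h2'⟩ := hpos k hk
        rw [h2, h2', List.prefix_append_right_inj] at hjk
        rw [h1, h1', List.prefix_append_right_inj]
        simpa using hjk
      · obtain ⟨t, h1, h2⟩ := hpos j hj
        rw [h2, hneg k hk] at hjk
        exact absurd (hext k ((List.prefix_append _ _).trans hjk)) hk
      · obtain ⟨t, h1, h2⟩ := hpos k hk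
        rw [h2, hneg j hj] at hjk
        rcases List.prefix_or_prefix_of_prefix hjk (List.prefix_append s t) with h | h
        · exact absurd h (hns j)
        · exact absurd (hext j h) hj
      · rwa [hneg j hj, hneg k hk] at hjk
    have hle : ∀ j, (c' j).length ≤ (c j).length := by
      intro j
      by_cases hj : s ++ [!b] <+: c j
      · obtain ⟨t, h1, h2⟩ := hpos j hj
        rw [h1, h2]; simp
      · rw [hneg j hj]
    have hlt : (c' i).length < (c i).length := by
      obtain ⟨t, h1, h2⟩ := hpos i (hext i hi)
      rw [h1, h2]; simp
    have := hc.2 c' hpre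
    refine absurd this (not_le.2 ?_)
    refine Finset.sum_lt_sum (fun j _ => ?_) ⟨i, Finset.mem_univ _, ?_⟩
    · exact mul_le_mul_of_nonneg_left (by exact_mod_cast hle j) (hp j).le
    · exact mul_lt_mul_of_pos_left (by exact_mod_cast hlt) (hp i)

/-- A prefix code for which every word is comparable with a codeword. -/
structure IsCompletePrefixCode {σ : ℕ} (c : Fin σ → List Bool) : Prop where
  prefixFree : IsPrefixCode c
  comparable : ∀ u, ∃ i, c i <+: u ∨ u <+: c i

/-! ### Codeword lengths and the size of the alphabet -/

theorem IsPrefixCode.length_pos {σ : ℕ} {c : Fin σ → List Bool} (hc : IsPrefixCode c)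
    (hσ : 2 ≤ σ) (i : Fin σ) : 0 < (c i).length := by
  by_contra h
  have h0 : c i = [] := by simpa using h
  have h1 := hc i ⟨0, by omega⟩ (h0 ▸ List.nil_prefix)
  have h2 := hc i ⟨1, by omega⟩ (h0 ▸ List.nil_prefix)
  rw [h1] at h2
  simp at h2

theorem length_le_maxCodewordLength {σ : ℕ} (c : Fin σ → List Bool) (i : Fin σ) :
    (c i).length ≤ maxCodewordLength c :=
  Finset.le_sup (f := fun i => (c i).length) (Finset.mem_univ i)

theorem IsPrefixCode.card_le {σ : ℕ} {c : Fin σ → List Bool} (hc : IsPrefixCode c) :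
    σ ≤ 2 ^ maxCodewordLength c := by
  set L := maxCodewordLength c
  let f : Fin σ → List.Vector Bool L := fun i =>
    ⟨c i ++ List.replicate (L - (c i).length) false, by
      have := length_le_maxCodewordLength c i
      simp; omega⟩
  have hf : Function.Injective f := by
    intro i j h
    have h' : c i ++ List.replicate (L - (c i).length) false
      = c j ++ List.replicate (L - (c j).length) false := congrArg Subtype.val h
    have hi : c i <+: c i ++ List.replicate (L - (c i).length) false := List.prefix_append _ _
    have hj : c j <+: c i ++ List.replicate (L - (c i).length) false :=
      h' ▸ List.prefix_append _ _
    rcases List.prefix_or_prefix_of_prefix hi hj with h | h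
    · exact hc _ _ h
    · exact (hc _ _ h).symm
  simpa using Fintype.card_le_of_injective f hf

/-- Each edge on the path to a codeword has a sibling off the path, and completeness puts a codeword
below every such sibling. These codewords differ, since two siblings disagree at the depth of the
shallower one. -/
theorem IsCompletePrefixCode.maxCodewordLength_le {σ : ℕ} {c : Fin σ → List Bool}
    (hc : IsCompletePrefixCode c) : maxCodewordLength c ≤ σ := by
  refine Finset.sup_le fun i _ => ?_
  set u : Fin (c i).length → List Bool := fun d => (c i).take d ++ [!(c i)[d]] with hu
  have hext : ∀ d, ∃ j, u d <+: c j := by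
    intro d
    obtain ⟨j, h | h⟩ := hc.comparable (u d)
    · rcases List.prefix_concat_iff.1 h with h | h
      · exact ⟨j, h ▸ List.prefix_rfl⟩
      · have h3 := hc.prefixFree j i (h.trans (List.take_prefix _ _))
        subst h3
        have := h.length_le
        simp at this
        omega
    · exact ⟨j, h⟩
  choose f hf using hext
  have hlt : ∀ d e : Fin (c i).length, d < e → f d ≠ f e := by
    intro d e hde h
    have h1 := hf d
    rw [h] at h1
    have h2 : u d <+: u e := List.prefix_of_prefix_length_le h1 (hf e) (by
      simp [hu]; omega)
    have h3 := h2.getElem (i := d) (by simp [hu])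
    have h4 : (d : ℕ) < e := hde
    simp only [hu] at h3
    rw [List.getElem_append_right (by simp), List.getElem_append_left (by simp; omega)] at h3
    simp at h3
  have hinj : Function.Injective f := by
    intro d e h
    rcases lt_trichotomy d e with h' | h' | h'
    · exact absurd h (hlt _ _ h')
    · exact h'
    · exact absurd h.symm (hlt _ _ h')
  simpa using Fintype.card_le_of_injective f hinj

/-! ### The nodes of the code tree, ordered by their reverses -/

/-- If `z` starts with `true` this is immediate; otherwise both words start with `false` and the
claim passes to the tails. The length hypothesis excludes cases such as `u = []`, `z = [false]`. -/
theorem List.cons_false_lt {u z : List Bool} (hl : z.length ≤ u.length) (h : u < z) :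
    false :: u < z := by
  induction z generalizing u with
  | nil => exact absurd h (List.not_lt_nil _)
  | cons b z ih =>
    cases b
    · match u with
      | [] => simp at hl
      | true :: u => exact absurd h (by simp [List.cons_lt_cons_iff])
      | false :: u =>
        have h1 : u < z := by simpa [List.cons_lt_cons_iff] using h
        have := ih (u := u) (by simpa using hl) h1
        simpa [List.cons_lt_cons_iff] using this
    · simp [List.cons_lt_cons_iff]

section Level

variable {σ : ℕ} (c : Fin σ → List Bool)

/-- The codewords of length `d`. -/
def levelLeaves (d : ℕ) : Finset (List Bool) :=
  (Finset.univ.filter fun i => (c i).length = d).image c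

/-- The proper prefixes of codewords that have length `d`. -/
def levelInternal (d : ℕ) : Finset (List Bool) :=
  (Finset.univ.filter fun i => d < (c i).length).image fun i => (c i).take d

/-- The prefixes of codewords that have length `d`. -/
def levelNodes (d : ℕ) : Finset (List Bool) := levelLeaves c d ∪ levelInternal c d

/-- The number of nodes on the level of `v` whose reverses are smaller than that of `v`. -/
def nodeIndex (v : List Bool) : ℕ :=
  ((levelNodes c v.length).filter fun u => u.reverse < v.reverse).card

variable {c}

theorem mem_levelLeaves {d : ℕ} {v : List Bool} :
    v ∈ levelLeaves c d ↔ ∃ i, (c i).length = d ∧ c i = v := by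
  simp [levelLeaves]

theorem mem_levelInternal {d : ℕ} {v : List Bool} :
    v ∈ levelInternal c d ↔ ∃ i, d < (c i).length ∧ (c i).take d = v := by
  simp [levelInternal]

theorem length_of_mem_levelInternal {d : ℕ} {v : List Bool} (h : v ∈ levelInternal c d) :
    v.length = d := by
  obtain ⟨i, hi, rfl⟩ := mem_levelInternal.1 h
  simp; omega

theorem length_of_mem_levelNodes {d : ℕ} {v : List Bool} (h : v ∈ levelNodes c d) :
    v.length = d := by
  rcases Finset.mem_union.1 h with h | h
  · obtain ⟨i, hi, rfl⟩ := mem_levelLeaves.1 h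
    exact hi
  · exact length_of_mem_levelInternal h

theorem IsPrefixCode.not_prefix_internal (hc : IsPrefixCode c) {d : ℕ} {v : List Bool}
    (hv : v ∈ levelInternal c d) (i : Fin σ) : ¬ c i <+: v := by
  obtain ⟨j, hj, rfl⟩ := mem_levelInternal.1 hv
  intro h
  have h3 := hc i j (h.trans (List.take_prefix _ _))
  subst h3
  have := h.length_le
  simp at this
  omega

theorem IsPrefixCode.disjoint_level (hc : IsPrefixCode c) (d : ℕ) :
    Disjoint (levelLeaves c d) (levelInternal c d) := by
  rw [Finset.disjoint_left]
  intro v hl hi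
  obtain ⟨i, -, rfl⟩ := mem_levelLeaves.1 hl
  exact hc.not_prefix_internal hi i List.prefix_rfl

/-- This is where the monotonicity of the lengths enters. Suppose an internal node `v` came before
the leaf `c i`. Completeness gives a codeword `c j` of the form `v` followed by zeros, and its
reverse is still smaller than that of `c i` by `List.cons_false_lt`. So `c j` is no longer than `v`,
which makes it a prefix of an internal node. -/
theorem IsCompletePrefixCode.leaf_lt_internal (hc : IsCompletePrefixCode c)
    (hm : LengthsMonotoneInReverseLex c) {d : ℕ} {x v : List Bool}
    (hx : x ∈ levelLeaves c d) (hv : v ∈ levelInternal c d) : x.reverse < v.reverse := by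
  obtain ⟨i, hi, rfl⟩ := mem_levelLeaves.1 hx
  have hvl := length_of_mem_levelInternal hv
  rcases lt_trichotomy (c i).reverse v.reverse with h | h | h
  · exact h
  · refine absurd ?_ (hc.prefixFree.not_prefix_internal hv i)
    rw [List.reverse_injective h]
  · exfalso
    -- With this many zeros the word is longer than every codeword, so a comparable codeword must be
    -- a prefix of it.
    obtain ⟨j, hj⟩ := hc.comparable (v ++ List.replicate (maxCodewordLength c + 1) false)
    have hj : c j <+: v ++ List.replicate (maxCodewordLength c + 1) false := by
      refine hj.resolve_right fun h' => ?_
      have h1 := h'.length_le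
      have h2 := length_le_maxCodewordLength c j
      simp at h1
      omega
    have hvj : v <+: c j :=
      (List.prefix_or_prefix_of_prefix hj (List.prefix_append v _)).resolve_left
        (hc.prefixFree.not_prefix_internal hv j)
    obtain ⟨t, ht⟩ := hvj
    rw [← ht, List.prefix_append_right_inj] at hj
    obtain ⟨k, hk⟩ : ∃ k, t = List.replicate k false :=
      ⟨t.length, List.eq_replicate_iff.2 ⟨rfl, fun b hb => List.eq_of_mem_replicate (hj.subset hb)⟩⟩
    subst hk
    have hrev : ∀ k, List.replicate k false ++ v.reverse < (c i).reverse := by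
      intro k
      induction k with
      | zero => simpa using h
      | succ k ih =>
        rw [List.replicate_succ, List.cons_append]
        exact List.cons_false_lt (by simp; omega) ih
    have hlen := hm j i (by rw [← ht]; simpa using hrev k)
    rw [← ht] at hlen
    have hk : k = 0 := by simp at hlen; omega
    subst hk
    refine hc.prefixFree.not_prefix_internal hv j ?_
    rw [← ht]; simp

/-- Completeness makes the tree full: an internal node has both children. -/
theorem IsCompletePrefixCode.levelNodes_succ (hc : IsCompletePrefixCode c) (d : ℕ) :
    levelNodes c (d + 1) =
      (levelInternal c d ×ˢ (Finset.univ : Finset Bool)).image fun q => q.1 ++ [q.2] := by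
  ext v
  simp only [Finset.mem_image, Finset.mem_product, Finset.mem_univ, and_true, Prod.exists]
  constructor
  · intro h
    obtain ⟨i, hi, rfl⟩ : ∃ i, d < (c i).length ∧ (c i).take (d + 1) = v := by
      rcases Finset.mem_union.1 h with h | h
      · obtain ⟨i, hi, rfl⟩ := mem_levelLeaves.1 h
        exact ⟨i, by omega, by rw [← hi, List.take_length]⟩
      · obtain ⟨i, hi, rfl⟩ := mem_levelInternal.1 h
        exact ⟨i, by omega, rfl⟩
    exact ⟨(c i).take d, (c i)[d], mem_levelInternal.2 ⟨i, hi, rfl⟩, by simp⟩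
  · rintro ⟨u, b, hu, rfl⟩
    have hl := length_of_mem_levelInternal hu
    obtain ⟨i, h | h⟩ := hc.comparable (u ++ [b])
    · rcases List.prefix_concat_iff.1 h with h | h
      · exact Finset.mem_union_left _ (mem_levelLeaves.2 ⟨i, by simp [h, hl], h⟩)
      · exact absurd h (hc.prefixFree.not_prefix_internal hu i)
    · rcases h.length_le.eq_or_lt with h' | h'
      · exact Finset.mem_union_left _ (mem_levelLeaves.2
          ⟨i, by simp [← h', hl], (h.eq_of_length h').symm⟩)
      · refine Finset.mem_union_right _ (mem_levelInternal.2 ⟨i, by simpa [hl] using h', ?_⟩)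
        have := List.prefix_iff_eq_take.1 h
        simpa [hl] using this.symm

theorem nodeIndex_nil : nodeIndex c [] = 0 := by
  simp [nodeIndex]

/-- Only leaves precede a leaf. Together with `nodeIndex_internal` this makes a comparison with the
number of leaves a test for being a leaf. -/
theorem IsCompletePrefixCode.nodeIndex_lt (hc : IsCompletePrefixCode c)
    (hm : LengthsMonotoneInReverseLex c) (i : Fin σ) :
    nodeIndex c (c i) < (levelLeaves c (c i).length).card := by
  have hi : c i ∈ levelLeaves c (c i).length := mem_levelLeaves.2 ⟨i, rfl, rfl⟩
  refine Finset.card_lt_card ⟨fun u hu => ?_, fun h => ?_⟩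
  · obtain ⟨h1, h2⟩ := Finset.mem_filter.1 hu
    refine (Finset.mem_union.1 h1).resolve_right fun h => ?_
    exact lt_asymm h2 (hc.leaf_lt_internal hm hi h)
  · exact lt_irrefl _ (Finset.mem_filter.1 (h hi)).2

theorem nodeIndex_strictMono {u v : List Bool} (hu : u ∈ levelNodes c v.length)
    (h : u.reverse < v.reverse) : nodeIndex c u < nodeIndex c v := by
  have hl := length_of_mem_levelNodes hu
  unfold nodeIndex
  rw [hl]
  refine Finset.card_lt_card ⟨fun x hx => ?_, fun h' => ?_⟩
  · rw [Finset.mem_filter] at hx ⊢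
    exact ⟨hx.1, hx.2.trans h⟩
  · exact lt_irrefl _ (Finset.mem_filter.1 (h' (Finset.mem_filter.2 ⟨hu, h⟩))).2

theorem IsPrefixCode.eq_of_nodeIndex_eq (hc : IsPrefixCode c) {i j : Fin σ}
    (hl : (c i).length = (c j).length) (h : nodeIndex c (c i) = nodeIndex c (c j)) : i = j := by
  have hi : c i ∈ levelNodes c (c j).length :=
    Finset.mem_union_left _ (mem_levelLeaves.2 ⟨i, hl, rfl⟩)
  have hj : c j ∈ levelNodes c (c i).length :=
    Finset.mem_union_left _ (mem_levelLeaves.2 ⟨j, hl.symm, rfl⟩)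
  rcases lt_trichotomy (c i).reverse (c j).reverse with h' | h' | h'
  · exact absurd h (nodeIndex_strictMono hi h').ne
  · exact hc.injective (List.reverse_injective h')
  · exact absurd h (nodeIndex_strictMono hj h').ne'

theorem IsCompletePrefixCode.nodeIndex_internal (hc : IsCompletePrefixCode c)
    (hm : LengthsMonotoneInReverseLex c) {d : ℕ} {v : List Bool} (hv : v ∈ levelInternal c d) :
    nodeIndex c v = (levelLeaves c d).card +
      ((levelInternal c d).filter fun u => u.reverse < v.reverse).card := by
  unfold nodeIndex levelNodes
  rw [length_of_mem_levelInternal hv, Finset.filter_union, Finset.card_union_of_disjoint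
    (Finset.disjoint_filter_filter (hc.prefixFree.disjoint_level d))]
  congr 2
  exact Finset.filter_true_of_mem fun u hu => hc.leaf_lt_internal hm hu hv

theorem card_filter_internal_lt {d : ℕ} {v : List Bool} (hv : v ∈ levelInternal c d) :
    ((levelInternal c d).filter fun u => u.reverse < v.reverse).card
      < (levelInternal c d).card := by
  refine Finset.card_lt_card ⟨Finset.filter_subset _ _, fun h => ?_⟩
  exact lt_irrefl _ (Finset.mem_filter.1 (h hv)).2

/-- The last bit of a word is the first of its reverse, so it dominates the comparison: a `1`-child
comes after all `0`-children of the level, and among children with equal bits the parents decide. -/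
theorem IsCompletePrefixCode.nodeIndex_child (hc : IsCompletePrefixCode c) {d : ℕ}
    {v : List Bool} (hv : v ∈ levelInternal c d) (b : Bool) :
    nodeIndex c (v ++ [b]) =
      ((levelInternal c d).filter fun u => u.reverse < v.reverse).card +
        b.toNat * (levelInternal c d).card := by
  unfold nodeIndex
  have hl := length_of_mem_levelInternal hv
  have hinj : Function.Injective fun q : List Bool × Bool => q.1 ++ [q.2] := by
    rintro ⟨u, a⟩ ⟨u', a'⟩ h
    simpa using h
  rw [List.length_append, hl, List.length_singleton, hc.levelNodes_succ, Finset.filter_image,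
    Finset.card_image_of_injective _ hinj]
  cases b
  · have : (levelInternal c d ×ˢ (Finset.univ : Finset Bool)).filter
        (fun q => (q.1 ++ [q.2]).reverse < (v ++ [false]).reverse) =
        ((levelInternal c d).filter fun u => u.reverse < v.reverse) ×ˢ {false} := by
      ext ⟨u, a⟩
      cases a <;> simp [List.cons_lt_cons_iff]
    rw [this]
    simp
  · have : (levelInternal c d ×ˢ (Finset.univ : Finset Bool)).filter
        (fun q => (q.1 ++ [q.2]).reverse < (v ++ [true]).reverse) =
        (((levelInternal c d).filter fun u => u.reverse < v.reverse) ×ˢ {true}) ∪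
          levelInternal c d ×ˢ {false} := by
      ext ⟨u, a⟩
      cases a <;> simp [List.cons_lt_cons_iff]
    rw [this, Finset.card_union_of_disjoint]
    · simp
    · rw [Finset.disjoint_left]
      rintro ⟨u, a⟩ h1 h2
      simp at h1 h2
      simp [h1.2] at h2

theorem IsPrefixCode.card_levelLeaves (hc : IsPrefixCode c) (d : ℕ) :
    (levelLeaves c d).card = (Finset.univ.filter fun i => (c i).length = d).card :=
  Finset.card_image_of_injective _ hc.injective

theorem card_levelLeaves_le_two_pow (d : ℕ) : (levelLeaves c d).card ≤ 2 ^ d := by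
  have : levelLeaves c d ⊆
      (Finset.univ : Finset (List.Vector Bool d)).image fun v => v.1 := by
    intro v hv
    obtain ⟨i, hi, rfl⟩ := mem_levelLeaves.1 hv
    exact Finset.mem_image.2 ⟨⟨c i, hi⟩, Finset.mem_univ _, rfl⟩
  simpa using (Finset.card_le_card this).trans Finset.card_image_le

theorem card_levelLeaves_le (d : ℕ) : (levelLeaves c d).card ≤ σ :=
  Finset.card_image_le.trans ((Finset.card_filter_le _ _).trans (by simp))

theorem card_levelInternal_le (d : ℕ) : (levelInternal c d).card ≤ σ :=
  Finset.card_image_le.trans ((Finset.card_filter_le _ _).trans (by simp))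

end Level

namespace WordRAM

/-! ### Bit fields of the data memory -/

/-- The `n`-bit number at position `p` of the binary expansion of `N`. -/
def field (N p n : ℕ) : ℕ := N / 2 ^ p % 2 ^ n

theorem field_lt (N p n : ℕ) : field N p n < 2 ^ n := Nat.mod_lt _ (by positivity)

theorem bitsToNat_lt (l : List Bool) : bitsToNat l < 2 ^ l.length := by
  induction l with
  | nil => simp [bitsToNat]
  | cons b l ih =>
    have : b.toNat ≤ 1 := Bool.toNat_le b
    simp only [bitsToNat, List.length_cons, pow_succ]
    omega

theorem bitsToNat_append (l l' : List Bool) :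
    bitsToNat (l ++ l') = bitsToNat l + 2 ^ l.length * bitsToNat l' := by
  induction l with
  | nil => simp [bitsToNat]
  | cons b l ih =>
    simp only [List.cons_append, bitsToNat, ih, List.length_cons, pow_succ]
    ring

theorem bitsToNat_take (l : List Bool) (n : ℕ) : bitsToNat (l.take n) = bitsToNat l % 2 ^ n := by
  rcases le_total n l.length with h | h
  · conv_rhs => rw [← List.take_append_drop n l, bitsToNat_append]
    have h1 := bitsToNat_lt (l.take n)
    rw [List.length_take, min_eq_left h] at h1 ⊢
    rw [Nat.add_mul_mod_self_left, Nat.mod_eq_of_lt h1]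
  · rw [List.take_of_length_le h, Nat.mod_eq_of_lt]
    exact (bitsToNat_lt l).trans_le (Nat.pow_le_pow_right two_pos h)

theorem bitsToNat_drop (l : List Bool) (n : ℕ) : bitsToNat (l.drop n) = bitsToNat l / 2 ^ n := by
  rcases le_total n l.length with h | h
  · conv_rhs => rw [← List.take_append_drop n l, bitsToNat_append]
    have h1 := bitsToNat_lt (l.take n)
    rw [List.length_take, min_eq_left h] at h1 ⊢
    rw [Nat.add_mul_div_left _ _ (by positivity), Nat.div_eq_of_lt h1, zero_add]
  · rw [List.drop_eq_nil_of_le h, Nat.div_eq_of_lt]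
    · rfl
    · exact (bitsToNat_lt l).trans_le (Nat.pow_le_pow_right two_pos h)

theorem dataWord_eq_field (w : ℕ) (data : List Bool) (a : ℕ) :
    dataWord w data a = field (bitsToNat data) (a * w) w := by
  rw [dataWord, bitsToNat_take, bitsToNat_drop, field]

/-- A field is assembled from two consecutive words by shifts. -/
theorem field_of_words {w n : ℕ} (N p : ℕ) (hw : 0 < w) (hn : n ≤ w) :
    (field N (p / w * w) w / 2 ^ (p % w) +
      field N ((p / w + 1) * w) w * 2 ^ (w - p % w) % 2 ^ w) % 2 ^ w % 2 ^ n = field N p n := by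
  have ho : p % w < w := Nat.mod_lt _ hw
  have hp : p = p / w * w + p % w := (Nat.div_add_mod' p w).symm
  generalize p / w = q at *
  generalize p % w = o at *
  subst hp
  have hA : N / 2 ^ ((q + 1) * w) = N / 2 ^ (q * w) / 2 ^ w := by
    rw [Nat.div_div_eq_div_mul, ← pow_add, add_mul, one_mul]
  have hB : N / 2 ^ (q * w + o) = N / 2 ^ (q * w) / 2 ^ o := by
    rw [Nat.div_div_eq_div_mul, ← pow_add]
  simp only [field, hA, hB]
  generalize N / 2 ^ (q * w) = A
  obtain ⟨k, rfl⟩ := Nat.exists_eq_add_of_lt ho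
  have e1 : 2 ^ (o + k + 1) = 2 ^ o * 2 ^ (k + 1) := by ring
  have e2 : o + k + 1 - o = k + 1 := by omega
  have h1 : A % 2 ^ (o + k + 1) / 2 ^ o = A / 2 ^ o % 2 ^ (k + 1) := by
    rw [e1, Nat.mod_mul_right_div_self]
  -- The left shift keeps only the lowest `o` bits of the second word. For `o = 0` it shifts by the
  -- full word length and contributes nothing.
  have h2 : A / 2 ^ (o + k + 1) % 2 ^ (o + k + 1) * 2 ^ (k + 1) % 2 ^ (o + k + 1) =
      2 ^ (k + 1) * (A / 2 ^ o / 2 ^ (k + 1) % 2 ^ o) := by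
    rw [Nat.div_div_eq_div_mul, ← e1]
    generalize A / 2 ^ (o + k + 1) = X
    rw [e1, Nat.mul_mod_mul_right, Nat.mod_mul_right_mod, mul_comm]
  rw [e2, h1, h2, ← Nat.mod_mul, mul_comm (2 ^ (k + 1)), ← e1, Nat.mod_mod,
    Nat.mod_mod_of_dvd _ (pow_dvd_pow 2 hn)]

/-- The run of `n` ones at the beginning of a number is isolated by an exclusive or. -/
theorem xor_succ_of_mod {x n : ℕ} (h : x % 2 ^ (n + 1) = 2 ^ n - 1) :
    x ^^^ (x + 1) = 2 ^ (n + 1) - 1 := by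
  induction n generalizing x with
  | zero =>
    obtain ⟨y, rfl⟩ : ∃ y, x = 2 * y := ⟨x / 2, by simp at h; omega⟩
    apply Nat.eq_of_testBit_eq
    intro i
    rcases i with _ | i
    · simp
    · have h1 : (2 * y + 1) / 2 = y := by omega
      have h2 : 2 * y / 2 = y := by omega
      rw [Nat.testBit_xor, Nat.testBit_succ, Nat.testBit_succ, h1, h2]
      simp [Nat.testBit_succ]
  | succ n ih =>
    have hp : 0 < 2 ^ n := by positivity
    have e : 2 ^ (n + 1 + 1) = 2 * 2 ^ (n + 1) := by ring
    have e' : 2 ^ (n + 1) = 2 * 2 ^ n := by ring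
    -- Adding one to an odd number carries into `y`, so the exclusive or is that of `y` and `y + 1`
    -- with a one appended as lowest bit.
    obtain ⟨y, rfl⟩ : ∃ y, x = 2 * y + 1 := by
      refine ⟨x / 2, ?_⟩
      have h1 := congrArg (· % 2) h
      simp only [e, Nat.mod_mul_right_mod] at h1
      omega
    have hy : y % 2 ^ (n + 1) = 2 ^ n - 1 := by
      rw [e, Nat.mod_mul] at h
      have : (2 * y + 1) / 2 = y := by omega
      rw [this] at h
      omega
    have h1 := ih hy
    apply Nat.eq_of_testBit_eq
    intro i
    rcases i with _ | i
    · simp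
      omega
    · have h2 : (2 * y + 1) / 2 = y := by omega
      have h3 : (2 * y + 1 + 1) / 2 = y + 1 := by omega
      rw [Nat.testBit_xor, Nat.testBit_succ, Nat.testBit_succ, h2, h3, ← Nat.testBit_xor, h1,
        Nat.testBit_two_pow_sub_one, Nat.testBit_two_pow_sub_one]
      simp

/-! ### Total correctness with time bounds -/

variable {w : ℕ} {data : List Bool}

/-- `P`, started in `s`, halts within time `T` in a state that satisfies `Q`. -/
def Runs (w : ℕ) (data : List Bool) (P : Prog) (s : State) (T : ℕ) (Q : State → Prop) : Prop :=
  ∃ (t : ℕ) (s' : State), Exec w data P s t s' ∧ t ≤ T ∧ Q s'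

namespace Runs

theorem mono {P : Prog} {s : State} {T T' : ℕ} {Q Q' : State → Prop} (h : Runs w data P s T Q)
    (hT : T ≤ T') (hQ : ∀ s', Q s' → Q' s') : Runs w data P s T' Q' := by
  obtain ⟨t, s', h1, h2, h3⟩ := h
  exact ⟨t, s', h1, h2.trans hT, hQ _ h3⟩

theorem nop {s : State} {Q : State → Prop} (h : Q s) : Runs w data .nop s 0 Q :=
  ⟨0, s, .nop s, le_rfl, h⟩

theorem instr {a : Instr} {s : State} {Q : State → Prop} (h : Q (a.exec w data s)) :
    Runs w data (.instr a) s 1 Q :=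
  ⟨1, _, .instr a s, le_rfl, h⟩

theorem seq {P R : Prog} {s : State} {T T' : ℕ} {Q : State → Prop}
    (h : Runs w data P s T fun s' => Runs w data R s' T' Q) :
    Runs w data (.seq P R) s (T + T') Q := by
  obtain ⟨t, s', h1, h2, t', s'', h3, h4, h5⟩ := h
  exact ⟨t + t', s'', .seq h1 h3, add_le_add h2 h4, h5⟩

theorem branch {r : ℕ} {P R : Prog} {s : State} {T : ℕ} {Q : State → Prop}
    (h1 : s.reg r ≠ 0 → Runs w data P s T Q) (h2 : s.reg r = 0 → Runs w data R s T Q) :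
    Runs w data (.branch r P R) s (T + 1) Q := by
  by_cases h : s.reg r = 0
  · obtain ⟨t, s', h1, h2, h3⟩ := h2 h
    exact ⟨t + 1, s', .branchFalse h h1, by omega, h3⟩
  · obtain ⟨t, s', h1, h2, h3⟩ := h1 h
    exact ⟨t + 1, s', .branchTrue h h1, by omega, h3⟩

/-- A loop with a variant: `I k s` says that the invariant holds with at most `k` rounds left. -/
theorem loop {r : ℕ} {P : Prog} {T : ℕ} {Q : State → Prop} (I : ℕ → State → Prop)
    (h : ∀ k s, I k s → (s.reg r = 0 ∧ Q s) ∨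
      (s.reg r ≠ 0 ∧ ∃ k', k = k' + 1 ∧ Runs w data P s T (I k')))
    {k : ℕ} {s : State} (hs : I k s) : Runs w data (.loop r P) s (k * (T + 1) + 1) Q := by
  induction k generalizing s with
  | zero =>
    rcases h _ _ hs with ⟨h1, h2⟩ | ⟨-, k', hk, -⟩
    · exact ⟨1, s, .loopFalse h1, by omega, h2⟩
    · omega
  | succ k ih =>
    rcases h _ _ hs with ⟨h1, h2⟩ | ⟨h1, k', hk, t, s', h2, h3, h4⟩
    · exact ⟨1, s, .loopFalse h1, by omega, h2⟩
    · obtain rfl : k = k' := by omega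
      obtain ⟨t', s'', h5, h6, h7⟩ := ih h4
      refine ⟨t + t' + 1, s'', .loopTrue h1 h2 h5, ?_, h7⟩
      rw [add_mul]
      omega

end Runs

/-- A sequence of instructions. -/
def block : List Instr → Prog
  | [] => .nop
  | a :: l => .seq (.instr a) (block l)

/-- The state after a sequence of instructions. -/
def runBlock (w : ℕ) (data : List Bool) : List Instr → State → State
  | [], s => s
  | a :: l, s => runBlock w data l (a.exec w data s)

theorem Runs.block {l : List Instr} {s : State} {Q : State → Prop}
    (h : Q (runBlock w data l s)) : Runs w data (block l) s l.length Q := by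
  induction l generalizing s with
  | nil => exact Runs.nop h
  | cons a l ih => exact ((Runs.instr (ih h)).seq).mono (by simp [add_comm]) fun _ h => h

/-! ### Reading fields -/

/-- Reads the entry with index `idx` of an array that begins at bit position `base` and whose
entries have `width` bits (all given in registers) into register `dest`, using registers
`1, …, 9`. -/
def getAt (base idx width dest : ℕ) : Prog :=
  block [.op .mul 1 idx width, .op .add 1 1 base, .op .or 2 width width, .wordSize 4,
    .op .div 5 1 4, .op .mod 6 1 4, .loadData 7 5, .op .shr 7 7 6, .const 8 1, .op .add 5 5 8,
    .loadData 9 5, .op .sub 4 4 6, .op .shl 9 9 4, .op .add 7 7 9, .op .shl 8 8 2,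
    .op .mod dest 7 8]

/-- Register `1` is overwritten before `base` and `width` are read for the last time, hence the two
disequalities. The bound on the position keeps the address of the second word from wrapping around,
and the strict bound on the width makes `2 ^ width`, the modulus that cuts out the entry, fit into a
word. -/
theorem Runs.getAt {base idx width dest : ℕ} {s : State} {Q : State → Prop}
    (hbase : base ≠ 1) (hwidth : width ≠ 1)
    (hpos : s.reg base + s.reg idx * s.reg width + 1 < 2 ^ w) (hW : s.reg width < w)
    (hQ : ∀ ρ : ℕ → ℕ,
      ρ dest = field (bitsToNat data) (s.reg base + s.reg idx * s.reg width) (s.reg width) →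
      (∀ r, r = 0 ∨ 10 ≤ r → r ≠ dest → ρ r = s.reg r) → Q { s with reg := ρ }) :
    Runs w data (getAt base idx width dest) s 16 Q := by
  refine Runs.block ?_
  simp only [runBlock, Instr.exec, State.setReg, BinOp.eval]
  refine hQ _ ?_ ?_
  · have hw : 0 < w := by omega
    have h1 : (1 : ℕ) % 2 ^ w = 1 := Nat.mod_eq_of_lt (Nat.one_lt_two_pow hw.ne')
    have h2 : s.reg idx * s.reg width % 2 ^ w = s.reg idx * s.reg width :=
      Nat.mod_eq_of_lt (by omega)
    have h3 : (s.reg idx * s.reg width + s.reg base) % 2 ^ w =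
        s.reg base + s.reg idx * s.reg width := by
      rw [Nat.mod_eq_of_lt (by omega)]
      omega
    have h4 : 2 ^ s.reg width % 2 ^ w = 2 ^ s.reg width :=
      Nat.mod_eq_of_lt (Nat.pow_lt_pow_right (by norm_num) hW)
    simp only [Function.update_apply, hbase, hwidth, Nat.reduceEqDiff, OfNat.ofNat_ne_one,
      OfNat.one_ne_ofNat, if_true, if_false, Nat.or_self, h1, h2, h3, h4, one_mul,
      dataWord_eq_field]
    generalize s.reg base + s.reg idx * s.reg width = p at *
    have h5 : (p / w + 1) % 2 ^ w = p / w + 1 :=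
      Nat.mod_eq_of_lt (by have := Nat.div_le_self p w; omega)
    have h6 : (w + (2 ^ w - p % w)) % 2 ^ w = w - p % w := by
      have h8 : p % w < w := Nat.mod_lt _ hw
      have h9 : w < 2 ^ w := Nat.lt_two_pow_self
      have : w + (2 ^ w - p % w) = (w - p % w) + 2 ^ w := by omega
      rw [this, Nat.add_mod_right, Nat.mod_eq_of_lt (by omega)]
    rw [h5, h6]
    exact field_of_words _ p hw hW.le
  · intro r hr hd
    have : ∀ k, 1 ≤ k → k ≤ 9 → r ≠ k := by omega
    simp [Function.update_of_ne, hd, this]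

end WordRAM

namespace WordRAM

variable {w : ℕ} {data : List Bool}

/-! ### The stored tables -/

/-- The contents of the data memory. The entries of the header are: the width `F` of wide entries,
the width `b` of narrow entries, the number of characters, and the positions of the arrays `leaves`,
`internal`, `start`, `len`, `anchor`, `width` and `pos`. The increasing sequence `key` is stored in
groups of `F` entries; entries are stored as differences to the `anchor` of their group, with
`width` bits each, from position `pos` on. -/
structure Tables where
  /-- the maximum level -/
  depth : ℕ
  header : ℕ → ℕ
  /-- the number of leaves on a level -/
  leaves : ℕ → ℕ
  /-- the number of internal nodes on a level -/
  internal : ℕ → ℕ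
  /-- the number of leaves on the levels above -/
  start : ℕ → ℕ
  /-- the codeword length of a character -/
  len : ℕ → ℕ
  anchor : ℕ → ℕ
  width : ℕ → ℕ
  pos : ℕ → ℕ
  key : ℕ → ℕ

namespace Tables

variable (T : Tables)

/-- The width of wide entries. -/
abbrev wide : ℕ := T.header 0

/-- The width of narrow entries. -/
abbrev narrow : ℕ := T.header 1

/-- The number of characters. -/
abbrev size : ℕ := T.header 2

/-- The tables are stored in the bits of the number `N`. -/
structure StoredIn (N : ℕ) : Prop where
  wide_pos : 0 < T.wide
  depth_lt : T.depth < 2 ^ T.wide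
  narrow_le : T.narrow ≤ T.wide
  prelude : N % 2 ^ (T.wide + 1) = 2 ^ T.wide - 1
  header : ∀ j ≤ 9, field N (T.wide + 1 + j * T.wide) T.wide = T.header j
  leaves : ∀ d ≤ T.depth, field N (T.header 3 + d * T.wide) T.wide = T.leaves d
  internal : ∀ d ≤ T.depth, field N (T.header 4 + d * T.wide) T.wide = T.internal d
  start : ∀ d ≤ T.depth, field N (T.header 5 + d * T.wide) T.wide = T.start d
  len : ∀ i < T.size, field N (T.header 6 + i * T.narrow) T.narrow = T.len i
  anchor : ∀ P < T.size, field N (T.header 7 + P / T.wide * T.wide) T.wide = T.anchor (P / T.wide)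
  width : ∀ P < T.size, field N (T.header 8 + P / T.wide * T.wide) T.wide = T.width (P / T.wide)
  pos : ∀ P < T.size, field N (T.header 9 + P / T.wide * T.wide) T.wide = T.pos (P / T.wide)
  key : ∀ P < T.size, field N (T.pos (P / T.wide) + P % T.wide * T.width (P / T.wide))
    (T.width (P / T.wide)) = T.key P - T.anchor (P / T.wide)
  anchor_le : ∀ P < T.size, T.anchor (P / T.wide) ≤ T.key P
  width_le : ∀ P < T.size, T.width (P / T.wide) ≤ T.wide
  key_lt : ∀ P < T.size, T.key P < 2 ^ T.wide

/-- The header is in registers `10, …, 19`. -/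
def Loaded (ρ : ℕ → ℕ) : Prop := ∀ j ≤ 9, ρ (10 + j) = T.header j

variable {T}

theorem Loaded.of_eq {ρ ρ' : ℕ → ℕ} (h : T.Loaded ρ)
    (h' : ∀ r, 10 ≤ r → r < 20 → ρ' r = ρ r) : T.Loaded ρ' :=
  fun j hj => (h' _ (by omega) (by omega)).trans (h j hj)

theorem StoredIn.header_lt {N : ℕ} (h : T.StoredIn N) {j : ℕ} (hj : j ≤ 9) :
    T.header j < 2 ^ T.wide := h.header j hj ▸ field_lt _ _ _

end Tables

open Tables

theorem pos_lt_two_pow {F w B I W : ℕ} (hF : 0 < F) (hw : 4 * F + 10 ≤ w) (hB : B < 2 ^ F)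
    (hI : I < 2 ^ F) (hW : W ≤ F) : B + I * W + 1 < 2 ^ w := by
  have h1 : F < 2 ^ F := Nat.lt_two_pow_self
  have h2 : I * W ≤ 2 ^ F * 2 ^ F := Nat.mul_le_mul hI.le (by omega)
  have h3 : 1 ≤ 2 ^ F := by omega
  have h4 : 2 ^ F ≤ 2 ^ F * 2 ^ F := Nat.le_mul_of_pos_left _ (by omega)
  have h5 : 2 ^ (F + F + 2) ≤ 2 ^ w := Nat.pow_le_pow_right (by norm_num) (by omega)
  rw [pow_add, pow_add] at h5
  omega

/-! ### Reading the header -/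

/-- Puts the width of wide entries into register `10` and the position of the header into
register `20`. -/
def loadWide : Prog :=
  block [.const 1 0, .loadData 2 1, .const 3 1, .op .add 4 2 3, .op .xor 4 2 4, .op .add 4 4 3,
    .op .div 5 2 4, .const 6 2, .op .div 6 4 6, .op .mod 10 5 6, .op .add 20 10 3]

/-- Loads the entries `1, …, n` of the header into registers `11, …, 10 + n`. -/
def loadEntries : ℕ → Prog
  | 0 => .nop
  | n + 1 => .seq (loadEntries n) (.seq (.instr (.const 21 (n + 1))) (getAt 20 21 10 (11 + n)))

/-- Loads the header. -/
def loadHeader : Prog := .seq loadWide (loadEntries 9)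

/-- The program must discover the field width by itself, in constant time. The memory starts with
that number in unary, ended by a zero; `xor_succ_of_mod` turns the run of ones into `2 ^ (wide +
1)`, and with this power the binary copy of the width behind it is cut out of the first word. -/
theorem runs_loadWide {T : Tables} (hT : T.StoredIn (bitsToNat data)) (hw : 4 * T.wide + 10 ≤ w)
    {s : State} {Q : State → Prop}
    (hQ : ∀ ρ : ℕ → ℕ, ρ 10 = T.wide → ρ 20 = T.wide + 1 → ρ 0 = s.reg 0 →
      Q { s with reg := ρ }) : Runs w data loadWide s 11 Q := by
  refine Runs.block ?_
  simp only [runBlock, Instr.exec, State.setReg, BinOp.eval]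
  have hF := hT.wide_pos
  have hh := hT.header 0 (by omega)
  have hlt := hT.header_lt (j := 0) (by omega)
  have hp := hT.prelude
  change field _ _ _ = T.wide at hh
  change T.wide < _ at hlt
  generalize T.wide = F at *
  set N := bitsToNat data with hN
  have e : 2 ^ (F + 1) = 2 * 2 ^ F := by ring
  have hw1 : 2 * F + 3 ≤ w := by omega
  obtain ⟨k, rfl⟩ := Nat.exists_eq_add_of_le hw1
  set w := 2 * F + 3 + k with hwdef
  have hpw : 2 ^ w = 2 * 2 ^ F * (4 * 2 ^ F * 2 ^ k) := by rw [hwdef]; ring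
  have h1 : (1 : ℕ) % 2 ^ w = 1 := Nat.mod_eq_of_lt (Nat.one_lt_two_pow (by omega))
  have h2 : (2 : ℕ) % 2 ^ w = 2 := by
    apply Nat.mod_eq_of_lt
    calc 2 = 2 ^ 1 := rfl
      _ < 2 ^ w := Nat.pow_lt_pow_right (by norm_num) (by omega)
  have h0 : dataWord w data 0 = N % 2 ^ w := by simp [dataWord_eq_field, field, hN]
  have hx : N % 2 ^ w % 2 ^ (F + 1) = 2 ^ F - 1 := by
    rw [Nat.mod_mod_of_dvd _ (pow_dvd_pow 2 (by omega)), hp]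
  have hxw : N % 2 ^ w < 2 ^ w := Nat.mod_lt _ (by positivity)
  have hpos : 0 < 2 ^ F := by positivity
  -- The zero that ends the run of ones keeps the increment from overflowing.
  have hsucc : (N % 2 ^ w + 1) % 2 ^ w = N % 2 ^ w + 1 := by
    apply Nat.mod_eq_of_lt
    have h3 : N % 2 ^ w + 1 ≠ 2 ^ w := by
      intro h4
      have h5 := congrArg (· % 2 ^ (F + 1)) h4
      have h6 : 2 ^ w % 2 ^ (F + 1) = 0 := Nat.mod_eq_zero_of_dvd (pow_dvd_pow 2 (by omega))
      simp only [h6] at h5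
      rw [Nat.add_mod, hx, e, Nat.mod_eq_of_lt (a := 1) (by omega),
        Nat.mod_eq_of_lt (by omega)] at h5
      omega
    omega
  have hxor := xor_succ_of_mod hx
  have hsub : 2 ^ (F + 1) - 1 + 1 = 2 ^ (F + 1) := by omega
  have hmod : 2 ^ (F + 1) % 2 ^ w = 2 ^ (F + 1) :=
    Nat.mod_eq_of_lt (Nat.pow_lt_pow_right (by norm_num) (by omega))
  have hdiv : 2 ^ (F + 1) / 2 = 2 ^ F := by omega
  have hread : N % 2 ^ w / 2 ^ (F + 1) % 2 ^ F = F := by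
    rw [hpw, ← e, Nat.mod_mul_right_div_self, Nat.mod_mod_of_dvd]
    · simpa [field] using hh
    · exact ⟨4 * 2 ^ k, by ring⟩
  have hadd : (F + 1) % 2 ^ w = F + 1 := by
    apply Nat.mod_eq_of_lt
    calc F + 1 < 2 ^ (F + 1) := Nat.lt_two_pow_self
      _ < 2 ^ w := Nat.pow_lt_pow_right (by norm_num) (by omega)
  apply hQ
  · simp only [Function.update_apply, Nat.reduceEqDiff, OfNat.ofNat_ne_one,
      if_true, if_false, Nat.zero_mod, h1, h2, h0, hsucc, hxor, hsub, hmod, hdiv, hread]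
  · simp only [Function.update_apply, Nat.reduceEqDiff, OfNat.ofNat_ne_one,
      if_true, if_false, Nat.zero_mod, h1, h2, h0, hsucc, hxor, hsub, hmod, hdiv, hread, hadd]
  · simp

theorem runs_loadEntries {T : Tables} (hT : T.StoredIn (bitsToNat data))
    (hw : 4 * T.wide + 10 ≤ w) {s : State} {Q : State → Prop} {n : ℕ} (hn : n ≤ 9)
    (h10 : s.reg 10 = T.wide) (h20 : s.reg 20 = T.wide + 1)
    (hQ : ∀ ρ : ℕ → ℕ, (∀ j ≤ n, ρ (10 + j) = T.header j) → ρ 20 = T.wide + 1 →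
      ρ 0 = s.reg 0 → Q { s with reg := ρ }) :
    Runs w data (loadEntries n) s (n * 17) Q := by
  induction n generalizing Q with
  | zero =>
    refine Runs.nop (hQ s.reg ?_ h20 rfl)
    intro j hj
    obtain rfl : j = 0 := by omega
    exact h10
  | succ n ih =>
    refine Runs.mono (Runs.seq (ih (by omega) fun ρ h1 h2 h3 => ?_)) (T := n * 17 + (1 + 16))
      (by omega) fun _ h => h
    refine Runs.seq (Runs.instr ?_)
    have e1 : (n + 1) % 2 ^ w = n + 1 := by
      apply Nat.mod_eq_of_lt
      calc n + 1 < 2 ^ (n + 1) := Nat.lt_two_pow_self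
        _ ≤ 2 ^ w := Nat.pow_le_pow_right (by norm_num) (by omega)
    have h10' : ρ 10 = T.wide := h1 0 (by omega)
    simp only [Instr.exec, State.setReg, e1]
    have hF := hT.wide_pos
    refine Runs.getAt (by norm_num) (by norm_num) ?_ ?_ ?_
    · simp [h2, h10']
      have : (n + 1) * T.wide ≤ 10 * T.wide := Nat.mul_le_mul_right _ (by omega)
      have h4 : T.wide < 2 ^ T.wide := Nat.lt_two_pow_self
      have h5 : 2 ^ (T.wide + 10) ≤ 2 ^ w := Nat.pow_le_pow_right (by norm_num) (by omega)
      rw [pow_add] at h5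
      omega
    · simp [h10']
      omega
    · intro ρ' h4 h5
      simp only [Function.update_apply, Nat.reduceEqDiff, if_true, if_false, h2, h10'] at h4
      refine hQ ρ' (fun j hj => ?_) ?_ ?_
      · rcases hj.eq_or_lt with rfl | hj
        · rw [show 10 + (n + 1) = 11 + n by omega, h4]
          exact hT.header _ hn
        · rw [h5 _ (by omega) (by omega)]
          simpa [show 10 + j ≠ 21 by omega] using h1 j (by omega)
      · rw [h5 _ (by omega) (by omega)]
        simpa using h2
      · rw [h5 _ (by omega) (by omega)]
        simpa using h3

theorem runs_loadHeader {T : Tables} (hT : T.StoredIn (bitsToNat data))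
    (hw : 4 * T.wide + 10 ≤ w) {s : State} {Q : State → Prop}
    (hQ : ∀ ρ : ℕ → ℕ, T.Loaded ρ → ρ 0 = s.reg 0 → Q { s with reg := ρ }) :
    Runs w data loadHeader s 164 Q :=
  Runs.seq (runs_loadWide hT hw fun _ h1 h2 h3 =>
    runs_loadEntries hT hw le_rfl h1 h2 fun ρ' h4 _ h6 => hQ ρ' h4 (h6.trans h3))

/-! ### Array access -/

theorem runs_getAt {T : Tables} (hT : T.StoredIn (bitsToNat data)) (hw : 4 * T.wide + 10 ≤ w)
    {base idx width dest B I W v : ℕ} {s : State} {Q : State → Prop}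
    (hbase : base ≠ 1) (hwidth : width ≠ 1) (hB : s.reg base = B) (hI : s.reg idx = I)
    (hW : s.reg width = W) (hBlt : B < 2 ^ T.wide) (hIlt : I < 2 ^ T.wide) (hWle : W ≤ T.wide)
    (hv : field (bitsToNat data) (B + I * W) W = v)
    (hQ : ∀ ρ : ℕ → ℕ, ρ dest = v →
      (∀ r, r = 0 ∨ 10 ≤ r → r ≠ dest → ρ r = s.reg r) → Q { s with reg := ρ }) :
    Runs w data (getAt base idx width dest) s 16 Q := by
  have hF := hT.wide_pos
  refine Runs.getAt hbase hwidth ?_ (by omega) ?_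
  · rw [hB, hI, hW]
    exact pos_lt_two_pow hF hw hBlt hIlt hWle
  · rwa [hB, hI, hW, hv]

/-- Reads the entry of the sequence `key` with the index in register `src` into register `dest`,
using registers `1, …, 9` and `40, …, 45`. -/
def keyAt (src dest : ℕ) : Prog :=
  .seq (block [.op .div 40 src 10, .op .mod 41 src 10]) <|
  .seq (getAt 17 40 10 42) <|
  .seq (getAt 18 40 10 43) <|
  .seq (getAt 19 40 10 44) <|
  .seq (getAt 44 41 43 45) <|
  .instr (.op .add dest 42 45)

/-- Anchor, width and position of the group are read first; the entry itself is a difference to the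
anchor. Register `40` is written between the two reads of `src`. -/
theorem runs_keyAt {T : Tables} (hT : T.StoredIn (bitsToNat data)) (hw : 4 * T.wide + 10 ≤ w)
    {src dest P : ℕ} {s : State} {Q : State → Prop} (hsrc : src ≠ 40) (hL : T.Loaded s.reg)
    (hP : s.reg src = P) (hPlt : P < T.size)
    (hQ : ∀ ρ : ℕ → ℕ, ρ dest = T.key P →
      (∀ r, r = 0 ∨ 10 ≤ r ∧ r < 40 ∨ 45 < r → r ≠ dest → ρ r = s.reg r) →
      Q { s with reg := ρ }) :
    Runs w data (keyAt src dest) s 67 Q := by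
  have hF := hT.wide_pos
  have hsz : T.size < 2 ^ T.wide := hT.header_lt (by omega)
  have hg : P / T.wide < 2 ^ T.wide := (Nat.div_le_self _ _).trans_lt (by omega)
  have hm : P % T.wide < 2 ^ T.wide := (Nat.mod_le _ _).trans_lt (by omega)
  have r10 : s.reg 10 = T.header 0 := hL 0 (by omega)
  refine Runs.mono (Runs.seq (Runs.block (Q := fun s' =>
    Runs w data _ s' (16 + (16 + (16 + (16 + 1)))) Q) ?_)) (by norm_num) fun _ h => h
  simp only [runBlock, Instr.exec, State.setReg, BinOp.eval, hP, r10, Function.update_apply, hsrc,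
    if_false, Nat.reduceEqDiff]
  refine Runs.seq (runs_getAt hT hw (B := T.header 7) (I := P / T.wide) (W := T.wide)
    (by norm_num) (by norm_num) (by simpa [Function.update_apply] using hL 7 (by omega))
    (by simp) (by simpa [Function.update_apply] using r10)
    (hT.header_lt (by omega)) hg le_rfl (hT.anchor P hPlt) fun ρ1 a1 b1 => ?_)
  refine Runs.seq (runs_getAt hT hw (B := T.header 8) (I := P / T.wide) (W := T.wide)
    (by norm_num) (by norm_num)
    (by simpa [Function.update_apply, b1] using hL 8 (by omega))
    (by simp [b1]) (by simpa [Function.update_apply, b1] using r10)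
    (hT.header_lt (by omega)) hg le_rfl (hT.width P hPlt) fun ρ2 a2 b2 => ?_)
  refine Runs.seq (runs_getAt hT hw (B := T.header 9) (I := P / T.wide) (W := T.wide)
    (by norm_num) (by norm_num)
    (by simpa [Function.update_apply, b1, b2] using hL 9 (by omega))
    (by simp [b1, b2])
    (by simpa [Function.update_apply, b1, b2] using r10)
    (hT.header_lt (by omega)) hg le_rfl (hT.pos P hPlt) fun ρ3 a3 b3 => ?_)
  have hpos : T.pos (P / T.wide) < 2 ^ T.wide := hT.pos P hPlt ▸ field_lt _ _ _
  refine Runs.seq (runs_getAt hT hw (I := P % T.wide) (by norm_num) (by norm_num) a3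
    (by simp [b1, b2, b3])
    (by simpa [b3] using a2) hpos hm (hT.width_le P hPlt) (hT.key P hPlt) fun ρ4 a4 b4 => ?_)
  refine Runs.instr ?_
  simp only [Instr.exec, State.setReg, BinOp.eval]
  have e42 : ρ4 42 = T.anchor (P / T.wide) := by simpa [b4, b3, b2] using a1
  have hk := hT.key_lt P hPlt
  have ha := hT.anchor_le P hPlt
  refine hQ _ ?_ ?_
  · rw [Function.update_self, e42, a4, Nat.add_sub_cancel' ha, Nat.mod_eq_of_lt]
    exact hk.trans_le (Nat.pow_le_pow_right (by norm_num) (by omega))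
  · intro r h1 h3
    have hr : ∀ k, 40 ≤ k → k ≤ 45 → r ≠ k := by omega
    have h1' : r = 0 ∨ 10 ≤ r := by omega
    rw [Function.update_of_ne h3]
    refine (b4 r h1' (hr _ (by omega) (by omega))).trans <|
      (b3 r h1' (hr _ (by omega) (by omega))).trans <|
      (b2 r h1' (hr _ (by omega) (by omega))).trans <|
      (b1 r h1' (hr _ (by omega) (by omega))).trans ?_
    simp [Function.update_of_ne, hr]

end WordRAM

namespace WordRAM

variable {w : ℕ} {data : List Bool}

open Tables

theorem sub_eval {w a b : ℕ} (hba : b ≤ a) (ha : a < 2 ^ w) : (a + (2 ^ w - b)) % 2 ^ w = a - b := by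
  have : a + (2 ^ w - b) = a - b + 2 ^ w := by omega
  rw [this, Nat.add_mod_right, Nat.mod_eq_of_lt (by omega)]

namespace Tables

/-- The tables describe the codeword `u` of the character `i`: the prefix of `u` of length `d` is
the node with number `x d` on level `d`, where the leaves of a level are numbered first. -/
structure IsCodeword (T : Tables) (i : ℕ) (u : List Bool) (x : ℕ → ℕ) : Prop where
  lt_size : i < T.size
  len_eq : T.len i = u.length
  length_pos : 0 < u.length
  length_le : u.length ≤ T.depth
  x_zero : x 0 = 0
  leaves_le : ∀ d < u.length, T.leaves d ≤ x d
  sub_lt : ∀ d < u.length, x d - T.leaves d < T.internal d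
  x_succ : ∀ (d : ℕ) (h : d < u.length),
    x (d + 1) = x d - T.leaves d + (u[d]).toNat * T.internal d
  x_last : x u.length < T.leaves u.length
  start_add_le : T.start u.length + T.leaves u.length ≤ T.size
  key_eq : T.key (T.start u.length + x u.length) = u.length * T.size + i
  key_strictMono : ∀ P Q, P < Q → Q < T.size → T.key P < T.key Q
  leaves_le_two_pow : T.leaves u.length ≤ 2 ^ u.length

variable {T : Tables} {N : ℕ}

theorem StoredIn.leaves_lt (hT : T.StoredIn N) {d : ℕ} (hd : d ≤ T.depth) :
    T.leaves d < 2 ^ T.wide := hT.leaves d hd ▸ field_lt _ _ _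

theorem StoredIn.internal_lt (hT : T.StoredIn N) {d : ℕ} (hd : d ≤ T.depth) :
    T.internal d < 2 ^ T.wide := hT.internal d hd ▸ field_lt _ _ _

theorem StoredIn.start_lt (hT : T.StoredIn N) {d : ℕ} (hd : d ≤ T.depth) :
    T.start d < 2 ^ T.wide := hT.start d hd ▸ field_lt _ _ _

theorem IsCodeword.x_lt {i : ℕ} {u : List Bool} {x : ℕ → ℕ} (hT : T.StoredIn N)
    (hu : T.IsCodeword i u x) {d : ℕ} (hd : d ≤ u.length) : x d < 2 * 2 ^ T.wide := by
  have h1 := hT.leaves_lt (hd.trans hu.length_le)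
  have h2 := hT.internal_lt (hd.trans hu.length_le)
  rcases hd.eq_or_lt with rfl | hd
  · have := hu.x_last
    omega
  · have := hu.sub_lt d hd
    omega

end Tables

/-- Ten spare bits: sums of a few wide entries do not wrap around, which lets `omega` remove the
reductions modulo `2 ^ w`. -/
theorem wide_bounds {F w : ℕ} (hw : 4 * F + 10 ≤ w) : 1024 * 2 ^ F ≤ 2 ^ w ∧ 1 ≤ 2 ^ F := by
  have h5 : 2 ^ (F + 10) ≤ 2 ^ w := Nat.pow_le_pow_right (by norm_num) (by omega)
  rw [pow_add] at h5
  exact ⟨by omega, Nat.one_le_two_pow⟩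

/-! ### The decoder -/

/-- One step from a node to a child. -/
def descendStep : Prog :=
  .seq (getAt 14 30 10 36) <|
  .seq (block [.readBit 37, .op .sub 31 31 32, .op .mul 38 37 36, .op .add 31 31 38, .const 34 1,
    .op .add 30 30 34]) <|
  .seq (getAt 13 30 10 32) <|
  block [.op .lt 33 31 32, .const 34 1, .op .sub 35 34 33]

/-- The decoder walks down the code tree and looks up the character of the leaf. -/
def decoder : Prog :=
  .seq loadHeader <|
  .seq (block [.const 30 0, .const 31 0]) <|
  .seq (getAt 13 30 10 32) <|
  .seq (block [.op .lt 33 31 32, .const 34 1, .op .sub 35 34 33]) <|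
  .seq (.loop 35 descendStep) <|
  .seq (getAt 15 30 10 39) <|
  .seq (.instr (.op .add 46 39 31)) <|
  .seq (keyAt 46 47) <|
  block [.op .mul 48 30 12, .op .sub 47 47 48, .op .or 0 47 47]

/-- The state of the decoder on level `d`. -/
structure DescendInv (T : Tables) (u rest : List Bool) (x : ℕ → ℕ) (d : ℕ) (s : State) :
    Prop where
  loaded : T.Loaded s.reg
  level : s.reg 30 = d
  node : s.reg 31 = x d
  leaves : s.reg 32 = T.leaves d
  flag : s.reg 35 = if x d < T.leaves d then 0 else 1
  input : s.input = u.drop d ++ rest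

theorem flag_eq {w a b : ℕ} (hw : 0 < w) :
    (1 % 2 ^ w + (2 ^ w - if a < b then 1 else 0)) % 2 ^ w = if a < b then 0 else 1 := by
  have h1 : (1 : ℕ) < 2 ^ w := Nat.one_lt_two_pow hw.ne'
  rw [Nat.mod_eq_of_lt h1]
  split_ifs <;> rw [sub_eval (by omega) h1]

/-- The program evaluates the recursion `x_succ` literally; the bounds on node numbers make the
modular arithmetic exact. -/
theorem runs_descendStep {T : Tables} (hT : T.StoredIn (bitsToNat data))
    (hw : 4 * T.wide + 10 ≤ w) {i : ℕ} {u rest : List Bool} {x : ℕ → ℕ}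
    (hu : T.IsCodeword i u x) {d : ℕ} (hd : d < u.length) {s : State}
    (hs : DescendInv T u rest x d s) :
    Runs w data descendStep s 41 (DescendInv T u rest x (d + 1)) := by
  obtain ⟨hw1, hw2⟩ := wide_bounds hw
  have hdd : d + 1 ≤ T.depth := (Nat.succ_le_of_lt hd).trans hu.length_le
  have hdl := hT.depth_lt
  have hx := hu.x_lt hT hd.le
  have hx' := hu.x_lt hT (d := d + 1) hd
  have hi := hT.internal_lt (d := d) (by omega)
  have r10 : s.reg 10 = T.header 0 := hs.loaded 0 (by omega)
  have r13 : s.reg 13 = T.header 3 := hs.loaded 3 (by omega)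
  have r14 : s.reg 14 = T.header 4 := hs.loaded 4 (by omega)
  refine Runs.mono (Runs.seq (runs_getAt hT hw (by norm_num) (by norm_num) r14 hs.level r10
    (hT.header_lt (by omega)) (by omega) le_rfl (hT.internal d (by omega))
    fun ρ1 a1 b1 => Runs.seq (Runs.block (Q := fun s' => Runs w data _ s' (16 + 3) _) ?_)))
    (by norm_num) fun _ h => h
  obtain ⟨b, hb, hb'⟩ : ∃ b, u[d] = b ∧ u.drop d = b :: u.drop (d + 1) :=
    ⟨_, rfl, List.drop_eq_getElem_cons hd⟩
  have hsucc := hu.x_succ d hd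
  have hle := hu.leaves_le d hd
  rw [hb] at hsucc
  have e1 : (b.toNat * T.internal d) % 2 ^ w = b.toNat * T.internal d := by
    apply Nat.mod_eq_of_lt
    cases b
    · simp
    · simp
      omega
  have e2 : (x d + (2 ^ w - T.leaves d)) % 2 ^ w = x d - T.leaves d := sub_eval hle (by omega)
  have e3 : (x d - T.leaves d + b.toNat * T.internal d) % 2 ^ w = x (d + 1) := by
    rw [← hsucc, Nat.mod_eq_of_lt (by omega)]
  have e4 : (d + 1 % 2 ^ w) % 2 ^ w = d + 1 := by
    rw [Nat.mod_eq_of_lt (a := 1) (by omega), Nat.mod_eq_of_lt (by omega)]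
  have r30 : ρ1 30 = d := by simpa [b1] using hs.level
  have r31 : ρ1 31 = x d := by simpa [b1] using hs.node
  have r32 : ρ1 32 = T.leaves d := by simpa [b1] using hs.leaves
  simp only [runBlock, Instr.exec, State.setReg, BinOp.eval, Function.update_apply,
    Nat.reduceEqDiff, if_true, if_false, hs.input, hb', List.cons_append, List.headD_cons,
    List.tail_cons, r30, r31, r32, a1, e1, e2, e3, e4]
  refine Runs.seq (runs_getAt hT hw (I := d + 1) (by norm_num) (by norm_num)
    (by simpa [Function.update_apply, b1] using r13)
    (by simp) (by simpa [Function.update_apply, b1] using r10)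
    (hT.header_lt (by omega)) (by omega) le_rfl (hT.leaves (d + 1) (by omega))
    fun ρ2 a2 b2 => Runs.block ?_)
  have r31' : ρ2 31 = x (d + 1) := by simp [b2]
  simp only [runBlock, Instr.exec, State.setReg, BinOp.eval, Function.update_apply,
    Nat.reduceEqDiff, if_true, if_false, a2, r31', flag_eq (show 0 < w by omega)]
  have hL : T.Loaded ρ2 := hs.loaded.of_eq fun r h1 h2 => by
    have : ∀ k, 30 ≤ k → r ≠ k := by omega
    simp [b2, b1, h1, this, Function.update_of_ne]
  exact ⟨hL.of_eq fun r h1 h2 => by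
      have : ∀ k, 30 ≤ k → r ≠ k := by omega
      simp [this, Function.update_of_ne],
    by simp [b2], by simpa using r31', by simpa using a2, by simp, rfl⟩

theorem decoder_spec {T : Tables} (hT : T.StoredIn (bitsToNat data)) (hw : 4 * T.wide + 10 ≤ w)
    {i : ℕ} {u : List Bool} {x : ℕ → ℕ} (hu : T.IsCodeword i u x) :
    DecodesWithin w data decoder i u (400 * u.length) := by
  intro rest
  have hpos := hu.length_pos
  obtain ⟨hw1, hw2⟩ := wide_bounds hw
  have hdd := hu.length_le
  have hdl := hT.depth_lt
  -- The cost is constant plus linear in the length; the constant is absorbed because codewords are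
  -- non-empty.
  suffices h : Runs w data decoder (initialState 0 (u ++ rest))
      (164 + (2 + (16 + (3 + ((u.length * (41 + 1) + 1) + (16 + (1 + (67 + 3))))))))
      (fun s => s.reg 0 = i ∧ s.input = rest) by
    obtain ⟨t, s, h1, h2, h3, h4⟩ := h
    exact ⟨t, s, h1, h3, h4, by omega⟩
  refine Runs.seq (runs_loadHeader hT hw fun ρ0 hL _ => Runs.seq (Runs.block ?_))
  simp only [runBlock, Instr.exec, State.setReg, Nat.zero_mod]
  refine Runs.seq (runs_getAt hT hw (B := T.header 3) (I := 0) (W := T.wide) (by norm_num)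
    (by norm_num) (by simpa [Function.update_apply] using hL 3 (by omega)) (by simp)
    (by simpa [Function.update_apply] using hL 0 (by omega)) (hT.header_lt (by omega)) (by omega)
    le_rfl (hT.leaves 0 (by omega)) fun ρ1 a1 b1 => Runs.seq (Runs.block ?_))
  have r31 : ρ1 31 = 0 := by simp [b1]
  simp only [runBlock, Instr.exec, State.setReg, BinOp.eval, Function.update_apply,
    Nat.reduceEqDiff, if_true, if_false, a1, r31, flag_eq (show 0 < w by omega)]
  refine Runs.seq ?_
  -- The variant is the number of levels still to descend. By `leaves_le` and `x_last` the flag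
  -- becomes zero exactly at the end of `u`, so no further bit is consumed.
  refine Runs.loop (fun k s => ∃ d, d + k = u.length ∧ DescendInv T u rest x d s) ?_
    (k := u.length) ⟨0, by omega, ?_⟩
  · rintro k s ⟨d, hdk, hs⟩
    rcases Nat.eq_zero_or_pos k with rfl | hk
    · obtain rfl : d = u.length := by omega
      refine Or.inl ⟨by rw [hs.flag, if_pos hu.x_last], ?_⟩
      have hxl := hu.x_last
      have hsa := hu.start_add_le
      have hll := hT.leaves_lt (d := u.length) (by omega)
      have hsl := hT.start_lt (d := u.length) (by omega)
      refine Runs.seq (runs_getAt hT hw (B := T.header 5) (I := u.length) (W := T.wide)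
        (by norm_num) (by norm_num) (hs.loaded 5 (by omega)) hs.level (hs.loaded 0 (by omega))
        (hT.header_lt (by omega)) (by omega) le_rfl (hT.start _ (by omega))
        fun ρ2 a2 b2 => Runs.seq (Runs.instr ?_))
      have e1 : (T.start u.length + x u.length) % 2 ^ w = T.start u.length + x u.length :=
        Nat.mod_eq_of_lt (by omega)
      have q31 : ρ2 31 = x u.length := by simpa [b2] using hs.node
      simp only [Instr.exec, State.setReg, BinOp.eval, a2, q31, e1]
      refine Runs.seq (runs_keyAt hT hw (P := T.start u.length + x u.length) (by norm_num)
        (hs.loaded.of_eq fun r h1 h2 => ?_) (by simp) (by omega) fun ρ3 a3 b3 => Runs.block ?_)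
      · have : ∀ k, 30 ≤ k → r ≠ k := by omega
        simp [b2, h1, this, Function.update_of_ne]
      · have q30 : ρ3 30 = u.length := by simpa [b3, b2] using hs.level
        have q12 : ρ3 12 = T.size := by simpa [b3, b2] using hs.loaded 2 (by omega)
        have hk := hT.key_lt (T.start u.length + x u.length) (by omega)
        rw [hu.key_eq] at hk a3
        have e2 : u.length * T.size % 2 ^ w = u.length * T.size := Nat.mod_eq_of_lt (by omega)
        simp only [runBlock, Instr.exec, State.setReg, BinOp.eval, Function.update_apply,
          Nat.reduceEqDiff, if_true, if_false, a3, q30, q12, Nat.or_self, e2]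
        refine ⟨?_, by simpa using hs.input⟩
        rw [sub_eval (by omega) (by omega)]
        omega
    · have hd : d < u.length := by omega
      refine Or.inr ⟨?_, k - 1, by omega, (runs_descendStep hT hw hu hd hs).mono le_rfl
        fun s' hs' => ⟨d + 1, by omega, hs'⟩⟩
      rw [hs.flag, if_neg (not_lt.2 (hu.leaves_le d hd))]
      norm_num
  · refine ⟨hL.of_eq fun r h1 h2 => ?_, ?_, ?_, ?_, ?_, rfl⟩
    · have : ∀ k, 30 ≤ k → r ≠ k := by omega
      simp [b1, h1, this, Function.update_of_ne]
    · simp [b1]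
    · simp [b1, hu.x_zero]
    · simp [a1]
    · simp [hu.x_zero]

end WordRAM

namespace WordRAM

variable {w : ℕ} {data : List Bool}

open Tables

/-! ### The encoder -/

/-- One step of the binary search for the key in register `33` between the positions in registers
`32` and `34`. -/
def searchStep : Prog :=
  .seq (block [.op .add 36 32 34, .const 37 2, .op .div 36 36 37]) <|
  .seq (keyAt 36 38) <|
  .seq (.instr (.op .lt 39 33 38)) <|
  .seq (.branch 39 (.instr (.op .or 34 36 36)) (.instr (.op .or 32 36 36))) <|
  block [.op .sub 36 34 32, .const 37 1, .op .lt 35 37 36]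

/-- One step from a node to its parent; the last bit of the node is written to the work memory. -/
def ascendStep : Prog :=
  .seq (block [.const 37 1, .op .sub 50 48 37]) <|
  .seq (getAt 14 50 10 51) <|
  .seq (getAt 13 50 10 52) <|
  block [.op .lt 53 47 51, .op .sub 54 37 53, .store 48 54, .op .mul 55 54 51, .op .sub 47 47 55,
    .op .add 47 47 52, .op .or 48 50 50]

/-- Copies one bit from the work memory to the output. -/
def emitStep : Prog :=
  block [.const 37 1, .op .add 48 48 37, .load 53 48, .writeBit 53, .op .sub 49 49 37]

/-- The encoder finds the position of the character among the characters with the same codeword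
length by binary search, and then walks up the code tree. -/
def encoder : Prog :=
  .seq loadHeader <|
  .seq (getAt 16 0 11 30) <|
  .seq (getAt 13 30 10 31) <|
  .seq (getAt 15 30 10 32) <|
  .seq (block [.op .mul 33 30 12, .op .add 33 33 0, .op .add 34 32 31, .op .or 46 32 32,
    .op .sub 36 34 32, .const 37 1, .op .lt 35 37 36]) <|
  .seq (.loop 35 searchStep) <|
  .seq (block [.op .sub 47 32 46, .op .or 48 30 30]) <|
  .seq (.loop 48 ascendStep) <|
  .seq (.instr (.op .or 49 30 30)) <|
  .loop 49 emitStep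

/-- The state of the binary search for position `P` between `lo` and `hi`. -/
structure SearchInv (T : Tables) (l P lo hi : ℕ) (s : State) : Prop where
  loaded : T.Loaded s.reg
  length : s.reg 30 = l
  start : s.reg 46 = T.start l
  key : s.reg 33 = T.key P
  lo_eq : s.reg 32 = lo
  hi_eq : s.reg 34 = hi
  lo_le : lo ≤ P
  lt_hi : P < hi
  hi_le : hi ≤ T.size
  flag : s.reg 35 = if 1 < hi - lo then 1 else 0
  output : s.output = []

/-- The interval always contains `P`, because the keys are strictly increasing; the final `+ 1`
accounts for intervals of odd length. -/
theorem runs_searchStep {T : Tables} (hT : T.StoredIn (bitsToNat data))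
    (hw : 4 * T.wide + 10 ≤ w) (hmono : ∀ P Q, P < Q → Q < T.size → T.key P < T.key Q)
    {l P lo hi : ℕ} (hlh : 1 < hi - lo) {s : State} (hs : SearchInv T l P lo hi s) :
    Runs w data searchStep s 76 fun s' => ∃ lo' hi', SearchInv T l P lo' hi' s' ∧
      2 * (hi' - lo') ≤ hi - lo + 1 := by
  obtain ⟨hw1, hw2⟩ := wide_bounds hw
  have hsz : T.size < 2 ^ T.wide := hT.header_lt (by omega)
  have hhi := hs.hi_le
  have hlo := hs.lo_le
  have hPhi := hs.lt_hi
  set mid := (lo + hi) / 2 with hmid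
  have e1 : (lo + hi) % 2 ^ w = lo + hi := Nat.mod_eq_of_lt (by omega)
  have e2 : 2 % 2 ^ w = 2 := Nat.mod_eq_of_lt (by omega)
  have e3 : 1 % 2 ^ w = 1 := Nat.mod_eq_of_lt (by omega)
  refine Runs.mono (Runs.seq (Runs.block (Q := fun s' => Runs w data _ s'
    (67 + (1 + (2 + 3))) _) ?_)) (by norm_num) fun _ h => h
  simp only [runBlock, Instr.exec, State.setReg, BinOp.eval, Function.update_apply,
    Nat.reduceEqDiff, if_true, if_false, hs.lo_eq, hs.hi_eq, e1, e2, ← hmid]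
  refine Runs.seq (runs_keyAt hT hw (P := mid) (by norm_num)
    (hs.loaded.of_eq fun r h1 h2 => ?_) (by simp) (by omega) fun ρ1 a1 b1 =>
      Runs.seq (Runs.instr ?_))
  · have : ∀ k, 30 ≤ k → r ≠ k := by omega
    simp [this, Function.update_of_ne]
  have hloaded : T.Loaded ρ1 := hs.loaded.of_eq fun r h1 h2 => by
    have : ∀ k, 30 ≤ k → r ≠ k := by omega
    rw [b1 r (by omega) (this _ (by norm_num))]
    simp [this, Function.update_of_ne]
  have r33 : ρ1 33 = T.key P := by simpa [b1] using hs.key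
  have r30 : ρ1 30 = l := by simpa [b1] using hs.length
  have r46 : ρ1 46 = T.start l := by simpa [b1] using hs.start
  have r32 : ρ1 32 = lo := by simpa [b1] using hs.lo_eq
  have r34 : ρ1 34 = hi := by simpa [b1] using hs.hi_eq
  have r36 : ρ1 36 = mid := by simp [b1]
  have hout := hs.output
  simp only [Instr.exec, State.setReg, BinOp.eval, r33, a1]
  refine Runs.seq (Runs.branch (fun h => Runs.instr (Runs.block ?_))
    fun h => Runs.instr (Runs.block ?_))
  · have hlt : T.key P < T.key mid := by
      by_contra hn
      simp [hn] at h
    have hPm : P < mid := by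
      by_contra hn
      rcases (not_lt.1 hn).eq_or_lt with h' | h'
      · rw [h'] at hlt
        omega
      · have := hmono _ _ h' (by omega)
        omega
    refine ⟨lo, mid, ?_, by omega⟩
    have e4 : (mid + (2 ^ w - lo)) % 2 ^ w = mid - lo := sub_eval (by omega) (by omega)
    simp only [runBlock, Instr.exec, State.setReg, BinOp.eval, Function.update_apply,
      Nat.reduceEqDiff, if_true, if_false, r36, r32, Nat.or_self, e3, e4]
    refine ⟨hloaded.of_eq fun r h1 h2 => ?_, by simp [r30], by simp [r46],
      by simp [r33], by simp [r32], by simp, hlo, hPm, by omega, by simp, hout⟩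
    have : ∀ k, 30 ≤ k → r ≠ k := by omega
    simp [this, Function.update_of_ne]
  · have hlt : ¬ T.key P < T.key mid := by
      intro hn
      simp [hn] at h
    have hPm : mid ≤ P := by
      by_contra hn
      exact hlt (hmono _ _ (not_le.1 hn) (by omega))
    refine ⟨mid, hi, ?_, by omega⟩
    have e4 : (hi + (2 ^ w - mid)) % 2 ^ w = hi - mid := sub_eval (by omega) (by omega)
    simp only [runBlock, Instr.exec, State.setReg, BinOp.eval, Function.update_apply,
      Nat.reduceEqDiff, if_true, if_false, r36, r34, Nat.or_self, e3, e4]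
    refine ⟨hloaded.of_eq fun r h1 h2 => ?_, by simp [r30], by simp [r46],
      by simp [r33], by simp, by simp [r34], hPm, hPhi, hhi, by simp, hout⟩
    have : ∀ k, 30 ≤ k → r ≠ k := by omega
    simp [this, Function.update_of_ne]

/-- The state of the encoder on level `d`, while it walks up. -/
structure AscendInv (T : Tables) (u : List Bool) (x : ℕ → ℕ) (d : ℕ) (s : State) : Prop where
  loaded : T.Loaded s.reg
  length : s.reg 30 = u.length
  level : s.reg 48 = d
  node : s.reg 47 = x d
  output : s.output = []
  work : ∀ (e : ℕ) (h : e < u.length), d ≤ e → s.work (e + 1) = (u[e]).toNat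

/-- Inverts `x_succ`: the parent's rank among the internal nodes is below `internal d`, so comparing
`x (d + 1)` with `internal d` reveals the bit, and subtraction gives the rank. Bits appear last to
first and are therefore buffered in the work memory. -/
theorem runs_ascendStep {T : Tables} (hT : T.StoredIn (bitsToNat data))
    (hw : 4 * T.wide + 10 ≤ w) {i : ℕ} {u : List Bool} {x : ℕ → ℕ}
    (hu : T.IsCodeword i u x) {d : ℕ} (hd : d < u.length) {s : State}
    (hs : AscendInv T u x (d + 1) s) :
    Runs w data ascendStep s 41 (AscendInv T u x d) := by
  obtain ⟨hw1, hw2⟩ := wide_bounds hw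
  have hdd : d + 1 ≤ T.depth := (Nat.succ_le_of_lt hd).trans hu.length_le
  have hdl := hT.depth_lt
  have hx := hu.x_lt hT hd.le
  have hx' := hu.x_lt hT (d := d + 1) hd
  have hi := hT.internal_lt (d := d) (by omega)
  obtain ⟨b, hb⟩ : ∃ b, u[d] = b := ⟨_, rfl⟩
  have hsucc := hu.x_succ d hd
  have hle := hu.leaves_le d hd
  have hlt := hu.sub_lt d hd
  rw [hb] at hsucc
  have e1 : 1 % 2 ^ w = 1 := Nat.mod_eq_of_lt (by omega)
  have e2 : (d + 1 + (2 ^ w - 1)) % 2 ^ w = d := by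
    rw [sub_eval (by omega) (by omega), Nat.add_sub_cancel]
  refine Runs.mono (Runs.seq (Runs.block (Q := fun s' => Runs w data _ s'
    (16 + (16 + 7)) _) ?_)) (by norm_num) fun _ h => h
  simp only [runBlock, Instr.exec, State.setReg, BinOp.eval, Function.update_apply,
    Nat.reduceEqDiff, if_true, if_false, hs.level, e1, e2]
  refine Runs.seq (runs_getAt hT hw (I := d) (by norm_num) (by norm_num)
    (by simpa [Function.update_apply] using hs.loaded 4 (by omega)) (by simp)
    (by simpa [Function.update_apply] using hs.loaded 0 (by omega))
    (hT.header_lt (by omega)) (by omega) le_rfl (hT.internal d (by omega)) fun ρ1 a1 b1 => ?_)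
  refine Runs.seq (runs_getAt hT hw (I := d) (by norm_num) (by norm_num)
    (by simpa [Function.update_apply, b1] using hs.loaded 3 (by omega)) (by simp [b1])
    (by simpa [Function.update_apply, b1] using hs.loaded 0 (by omega))
    (hT.header_lt (by omega)) (by omega) le_rfl (hT.leaves d (by omega)) fun ρ2 a2 b2 =>
      Runs.block ?_)
  have r51 : ρ2 51 = T.internal d := by simpa [b2] using a1
  have r47 : ρ2 47 = x (d + 1) := by simpa [b2, b1] using hs.node
  have r48 : ρ2 48 = d + 1 := by simpa [b2, b1] using hs.level
  have r50 : ρ2 50 = d := by simp [b2, b1]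
  have r37 : ρ2 37 = 1 := by simp [b2, b1]
  have r30 : ρ2 30 = u.length := by simpa [b2, b1] using hs.length
  have hL : T.Loaded ρ2 := hs.loaded.of_eq fun r h1 h2 => by
    have : ∀ k, 30 ≤ k → r ≠ k := by omega
    simp [b2, b1, h1, this, Function.update_of_ne]
  have hbit : (1 + (2 ^ w - if x (d + 1) < T.internal d then 1 else 0)) % 2 ^ w = b.toNat := by
    cases b
    · simp only [Bool.toNat_false, zero_mul, add_zero] at hsucc
      rw [if_pos (by omega), sub_eval le_rfl (by omega)]
      rfl
    · simp only [Bool.toNat_true, one_mul] at hsucc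
      rw [if_neg (by omega), sub_eval (by omega) (by omega)]
      rfl
  have e3 : b.toNat * T.internal d % 2 ^ w = b.toNat * T.internal d := by
    apply Nat.mod_eq_of_lt
    cases b
    · simp
    · simp
      omega
  have e4 : (x (d + 1) + (2 ^ w - b.toNat * T.internal d)) % 2 ^ w = x d - T.leaves d := by
    rw [sub_eval (by omega) (by omega)]
    omega
  have e5 : (x d - T.leaves d + T.leaves d) % 2 ^ w = x d := by
    rw [Nat.sub_add_cancel hle, Nat.mod_eq_of_lt (by omega)]
  simp only [runBlock, Instr.exec, State.setReg, BinOp.eval, Function.update_apply,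
    Nat.reduceEqDiff, if_true, if_false, r51, r47, r48, r50, r37, a2, Nat.or_self, hbit, e3, e4, e5]
  refine ⟨hL.of_eq fun r h1 h2 => ?_, by simp [r30], by simp, by simp, hs.output, ?_⟩
  · have : ∀ k, 30 ≤ k → r ≠ k := by omega
    simp [this, Function.update_of_ne]
  · intro e he hde
    rcases hde.eq_or_lt with rfl | hde
    · simp [hb]
    · have := hs.work e he hde
      simpa [Function.update_apply, show e ≠ d by omega] using this

theorem runs_emitStep (hw : 0 < w) {u : List Bool} {k : ℕ} (hk : k < u.length)
    (hlt : u.length < 2 ^ w) {s : State}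
    (hwork : ∀ (e : ℕ) (h : e < u.length), s.work (e + 1) = (u[e]).toNat)
    (h49 : s.reg 49 = u.length - k) (h48 : s.reg 48 = k) (hout : s.output = u.take k) :
    Runs w data emitStep s 5 fun s' => s'.work = s.work ∧ s'.reg 49 = u.length - (k + 1) ∧
      s'.reg 48 = k + 1 ∧ s'.output = u.take (k + 1) := by
  have e1 : 1 % 2 ^ w = 1 := Nat.mod_eq_of_lt (Nat.one_lt_two_pow hw.ne')
  have e2 : (k + 1) % 2 ^ w = k + 1 := Nat.mod_eq_of_lt (by omega)
  have e3 : (u.length - k + (2 ^ w - 1)) % 2 ^ w = u.length - (k + 1) := by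
    rw [sub_eval (by omega) (by omega)]
    omega
  refine Runs.block ?_
  simp only [runBlock, Instr.exec, State.setReg, BinOp.eval, Function.update_apply,
    Nat.reduceEqDiff, if_true, if_false, h49, h48, e1, e2, e3, hwork k hk, hout]
  refine ⟨trivial, trivial, trivial, ?_⟩
  rw [List.take_succ_eq_append_getElem hk]
  cases u[k] <;> simp

theorem encoder_spec {T : Tables} (hT : T.StoredIn (bitsToNat data)) (hw : 4 * T.wide + 10 ≤ w)
    {i : ℕ} {u : List Bool} {x : ℕ → ℕ} (hu : T.IsCodeword i u x) :
    EncodesWithin w data encoder i u (400 * u.length) := by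
  have hpos := hu.length_pos
  obtain ⟨hw1, hw2⟩ := wide_bounds hw
  have hdd := hu.length_le
  have hdl := hT.depth_lt
  have hsz : T.size < 2 ^ T.wide := hT.header_lt (by omega)
  have hi := hu.lt_size
  have hxl := hu.x_last
  have hsa := hu.start_add_le
  have hll := hT.leaves_lt (d := u.length) (by omega)
  have hsl := hT.start_lt (d := u.length) (by omega)
  suffices h : Runs w data encoder (initialState i [])
      (164 + (16 + (16 + (16 + (7 + (u.length * (76 + 1) + 1 + (2 + (u.length * (41 + 1) + 1 +
        (1 + (u.length * (5 + 1) + 1)))))))))) (fun s => s.output = u) by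
    obtain ⟨t, s, h1, h2, h3⟩ := h
    exact ⟨t, s, h1, h3, by omega⟩
  refine Runs.seq (runs_loadHeader hT hw fun ρ0 hL h0 => ?_)
  have h0 : ρ0 0 = i := h0
  refine Runs.seq (runs_getAt hT hw (by norm_num) (by norm_num) (hL 6 (by omega)) h0
    (hL 1 (by omega)) (hT.header_lt (by omega)) (by omega) hT.narrow_le (hT.len i hi)
    fun ρ1 a1 b1 => ?_)
  rw [hu.len_eq] at a1
  refine Runs.seq (runs_getAt hT hw (B := T.header 3) (W := T.wide) (by norm_num) (by norm_num)
    (by simpa [b1] using hL 3 (by omega)) a1 (by simpa [b1] using hL 0 (by omega))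
    (hT.header_lt (by omega)) (by omega) le_rfl (hT.leaves _ hdd) fun ρ2 a2 b2 => ?_)
  refine Runs.seq (runs_getAt hT hw (B := T.header 5) (I := u.length) (W := T.wide) (by norm_num)
    (by norm_num) (by simpa [b2, b1] using hL 5 (by omega)) (by simpa [b2] using a1)
    (by simpa [b2, b1] using hL 0 (by omega))
    (hT.header_lt (by omega)) (by omega) le_rfl (hT.start _ hdd) fun ρ3 a3 b3 => ?_)
  have hL3 : T.Loaded ρ3 := hL.of_eq fun r h1 h2 => by
    have : ∀ k, 30 ≤ k → r ≠ k := by omega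
    simp [b3, b2, b1, h1, this]
  have r30 : ρ3 30 = u.length := by simpa [b3, b2] using a1
  have r31 : ρ3 31 = T.leaves u.length := by simpa [b3] using a2
  have r0 : ρ3 0 = i := by simpa [b3, b2, b1] using h0
  have r12 : ρ3 12 = T.size := hL3 2 (by omega)
  have hk := hT.key_lt (T.start u.length + x u.length) (by omega)
  have hk' := hu.key_eq
  rw [hk'] at hk
  have e1 : u.length * T.size % 2 ^ w = u.length * T.size := Nat.mod_eq_of_lt (by omega)
  have e2 : (u.length * T.size + i) % 2 ^ w = u.length * T.size + i := Nat.mod_eq_of_lt (by omega)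
  have e3 : (T.start u.length + T.leaves u.length) % 2 ^ w =
    T.start u.length + T.leaves u.length := Nat.mod_eq_of_lt (by omega)
  have e4 : (T.start u.length + T.leaves u.length + (2 ^ w - T.start u.length)) % 2 ^ w =
      T.leaves u.length := by
    rw [sub_eval (by omega) (by omega)]
    omega
  have e5 : 1 % 2 ^ w = 1 := Nat.mod_eq_of_lt (by omega)
  refine Runs.seq (Runs.block ?_)
  simp only [runBlock, Instr.exec, State.setReg, BinOp.eval, Function.update_apply,
    Nat.reduceEqDiff, if_true, if_false, a3, r30, r31, r0, r12, Nat.or_self, e1, e2, e3, e4, e5,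
    OfNat.zero_ne_ofNat]
  refine Runs.seq ?_
  -- A level `ℓ` has at most `2 ^ ℓ` leaves, so `ℓ` halvings suffice and the search is paid for by
  -- the codeword length.
  refine Runs.loop (fun k s => ∃ lo hi, hi - lo ≤ 2 ^ k ∧
    SearchInv T u.length (T.start u.length + x u.length) lo hi s) ?_
    (k := u.length) ⟨T.start u.length, T.start u.length + T.leaves u.length, ?_, ?_⟩
  · rintro k s ⟨lo, hi, hk, hs⟩
    by_cases hlh : 1 < hi - lo
    · refine Or.inr ⟨by rw [hs.flag, if_pos hlh]; norm_num, ?_⟩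
      rcases k with _ | k
      · simp at hk
        omega
      · refine ⟨k, rfl, (runs_searchStep hT hw hu.key_strictMono hlh hs).mono le_rfl ?_⟩
        rintro s' ⟨lo', hi', h1, h2⟩
        refine ⟨lo', hi', ?_, h1⟩
        rw [pow_succ] at hk
        omega
    · refine Or.inl ⟨by rw [hs.flag, if_neg hlh], Runs.seq (Runs.block ?_)⟩
      have h1 := hs.lo_le
      have h2 := hs.lt_hi
      obtain rfl : lo = T.start u.length + x u.length := by omega
      have e6 : (T.start u.length + x u.length + (2 ^ w - T.start u.length)) % 2 ^ w =
          x u.length := by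
        rw [sub_eval (by omega) (by omega)]
        omega
      simp only [runBlock, Instr.exec, State.setReg, BinOp.eval, Function.update_apply,
        Nat.reduceEqDiff, if_false, hs.lo_eq, hs.start, hs.length, Nat.or_self, e6]
      refine Runs.seq ?_
      refine Runs.loop (fun k s => k ≤ u.length ∧ AscendInv T u x k s) ?_
        (k := u.length) ⟨le_rfl, ?_⟩
      · rintro k s ⟨hku, hs⟩
        rcases k with _ | k
        · refine Or.inl ⟨hs.level, Runs.seq (Runs.instr ?_)⟩
          simp only [Instr.exec, State.setReg, BinOp.eval, hs.length, Nat.or_self]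
          refine Runs.loop (fun k s => ∃ d, d + k = u.length ∧ s.reg 49 = u.length - d ∧
            s.reg 48 = d ∧ s.output = u.take d ∧
            ∀ (e : ℕ) (h : e < u.length), s.work (e + 1) = (u[e]).toNat) ?_
            (k := u.length) ⟨0, by omega, by simp, by simpa using hs.level, by simpa using hs.output,
              fun e he => hs.work e he (by omega)⟩
          rintro k s ⟨d, hd, h49, h48, hout, hwork⟩
          rcases k with _ | k
          · obtain rfl : d = u.length := by omega
            exact Or.inl ⟨by omega, by simpa using hout⟩
          · refine Or.inr ⟨by omega, k, rfl,
              (runs_emitStep (by omega) (by omega) (by omega) hwork h49 h48 hout).mono le_rfl ?_⟩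
            rintro s' ⟨q1, q2, q3, q4⟩
            exact ⟨d + 1, by omega, q2, q3, q4, q1 ▸ hwork⟩
        · exact Or.inr ⟨by rw [hs.level]; omega, k, rfl,
            (runs_ascendStep hT hw hu (by omega) hs).mono le_rfl fun s' hs' => ⟨by omega, hs'⟩⟩
      · refine ⟨hs.loaded.of_eq fun r h1 h2 => ?_, by simp [hs.length], by simp, by simp,
          hs.output, fun e he hle => by omega⟩
        have : ∀ k, 30 ≤ k → r ≠ k := by omega
        simp [this, Function.update_of_ne]
  · have := hu.leaves_le_two_pow
    omega
  · refine ⟨hL3.of_eq fun r h1 h2 => ?_, by simp [r30], by simp, by simp [hk'], by simp [a3],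
      by simp, by omega, by omega, hsa, by simp, rfl⟩
    have : ∀ k, 30 ≤ k → r ≠ k := by omega
    simp [this, Function.update_of_ne]

end WordRAM

namespace WordRAM

/-! ### Lists of fields -/

/-- The `n` lowest binary digits of `v`, least significant digit first. -/
def natToBits : ℕ → ℕ → List Bool
  | 0, _ => []
  | n + 1, v => decide (v % 2 = 1) :: natToBits n (v / 2)

theorem length_natToBits (n v : ℕ) : (natToBits n v).length = n := by
  induction n generalizing v with
  | zero => rfl
  | succ n ih => simp [natToBits, ih]

theorem bitsToNat_natToBits (n v : ℕ) : bitsToNat (natToBits n v) = v % 2 ^ n := by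
  induction n generalizing v with
  | zero => simp [natToBits, bitsToNat, Nat.mod_one]
  | succ n ih =>
    rw [natToBits, bitsToNat, ih, pow_succ', Nat.mod_mul]
    rcases Nat.mod_two_eq_zero_or_one v with h | h <;> simp [h]

/-- The bit string that consists of fields with given widths and values. -/
def encodeFields (l : List (ℕ × ℕ)) : List Bool := l.flatMap fun q => natToBits q.1 q.2

/-- The sum of the widths of the fields. -/
def totalWidth (l : List (ℕ × ℕ)) : ℕ := (l.map Prod.fst).sum

theorem length_encodeFields (l : List (ℕ × ℕ)) : (encodeFields l).length = totalWidth l := by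
  simp [encodeFields, totalWidth, List.length_flatMap, length_natToBits]

theorem encodeFields_append (l l' : List (ℕ × ℕ)) :
    encodeFields (l ++ l') = encodeFields l ++ encodeFields l' := List.flatMap_append

theorem totalWidth_append (l l' : List (ℕ × ℕ)) :
    totalWidth (l ++ l') = totalWidth l + totalWidth l' := by
  simp [totalWidth]

/-- The number whose binary digits are the fields. -/
def fieldsNat (l : List (ℕ × ℕ)) : ℕ := bitsToNat (encodeFields l)

theorem fieldsNat_append (l l' : List (ℕ × ℕ)) :
    fieldsNat (l ++ l') = fieldsNat l + 2 ^ totalWidth l * fieldsNat l' := by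
  rw [fieldsNat, encodeFields_append, bitsToNat_append, length_encodeFields, fieldsNat, fieldsNat]

theorem fieldsNat_lt (l : List (ℕ × ℕ)) : fieldsNat l < 2 ^ totalWidth l := by
  rw [← length_encodeFields]
  exact bitsToNat_lt _

theorem field_append_right (l l' : List (ℕ × ℕ)) (p n : ℕ) :
    field (fieldsNat (l ++ l')) (totalWidth l + p) n = field (fieldsNat l') p n := by
  rw [fieldsNat_append, field, field, pow_add, ← Nat.div_div_eq_div_mul,
    Nat.add_mul_div_left _ _ (by positivity), Nat.div_eq_of_lt (fieldsNat_lt l), zero_add]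

theorem field_append_left (l l' : List (ℕ × ℕ)) {p n : ℕ} (h : p + n ≤ totalWidth l) :
    field (fieldsNat (l ++ l')) p n = field (fieldsNat l) p n := by
  obtain ⟨k, hk⟩ := Nat.exists_eq_add_of_le h
  have : 2 ^ totalWidth l * fieldsNat l' = 2 ^ p * (2 ^ n * (2 ^ k * fieldsNat l')) := by
    rw [hk, pow_add, pow_add]
    ring
  rw [fieldsNat_append, field, field, this, Nat.add_mul_div_left _ _ (by positivity),
    Nat.add_mul_mod_self_left]

/-- An array of `k` fields of width `n`. -/
def fieldArray (n k : ℕ) (f : ℕ → ℕ) : List (ℕ × ℕ) := (List.range k).map fun j => (n, f j)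

theorem fieldArray_succ (n k : ℕ) (f : ℕ → ℕ) :
    fieldArray n (k + 1) f = fieldArray n k f ++ [(n, f k)] := by
  simp [fieldArray, List.range_succ]

theorem totalWidth_fieldArray (n k : ℕ) (f : ℕ → ℕ) : totalWidth (fieldArray n k f) = k * n := by
  simp [totalWidth, fieldArray, Function.comp_def]

theorem field_singleton (n v : ℕ) : field (fieldsNat [(n, v)]) 0 n = v % 2 ^ n := by
  simp [fieldsNat, encodeFields, bitsToNat_natToBits, field]

theorem field_fieldArray {n k : ℕ} {f : ℕ → ℕ} {j : ℕ} (hj : j < k) (hf : f j < 2 ^ n) :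
    field (fieldsNat (fieldArray n k f)) (j * n) n = f j := by
  induction k with
  | zero => omega
  | succ k ih =>
    rw [fieldArray_succ]
    rcases Nat.lt_succ_iff_lt_or_eq.1 hj with h | rfl
    · rw [field_append_left, ih h]
      rw [totalWidth_fieldArray, ← Nat.succ_mul]
      exact Nat.mul_le_mul_right _ h
    · have := field_append_right (fieldArray n j f) [(n, f j)] 0 n
      rw [totalWidth_fieldArray, add_zero, field_singleton, Nat.mod_eq_of_lt hf] at this
      exact this

/-- Groups of `F` fields each, where the fields of group `g` have width `width g`. -/
def fieldGroups (F : ℕ) (width : ℕ → ℕ) (val : ℕ → ℕ → ℕ) : ℕ → List (ℕ × ℕ)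
  | 0 => []
  | g + 1 => fieldGroups F width val g ++ fieldArray (width g) F (val g)

theorem totalWidth_fieldGroups (F : ℕ) (width : ℕ → ℕ) (val : ℕ → ℕ → ℕ) (g : ℕ) :
    totalWidth (fieldGroups F width val g) = ∑ k ∈ Finset.range g, F * width k := by
  induction g with
  | zero => rfl
  | succ g ih => rw [fieldGroups, totalWidth_append, ih, totalWidth_fieldArray,
      Finset.sum_range_succ]

theorem field_fieldGroups {F : ℕ} {width : ℕ → ℕ} {val : ℕ → ℕ → ℕ} {n g j : ℕ} (hg : g < n)
    (hj : j < F) (hv : val g j < 2 ^ width g) :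
    field (fieldsNat (fieldGroups F width val n))
      (∑ k ∈ Finset.range g, F * width k + j * width g) (width g) = val g j := by
  induction n with
  | zero => omega
  | succ n ih =>
    rw [fieldGroups]
    have h1 : j * width g + width g ≤ F * width g := by
      rw [← Nat.succ_mul]
      exact Nat.mul_le_mul_right _ hj
    rcases Nat.lt_succ_iff_lt_or_eq.1 hg with h | rfl
    · rw [field_append_left, ih h]
      rw [totalWidth_fieldGroups]
      have h2 : ∑ k ∈ Finset.range (g + 1), F * width k ≤ ∑ k ∈ Finset.range n, F * width k :=
        Finset.sum_le_sum_of_subset (Finset.range_mono h)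
      rw [Finset.sum_range_succ] at h2
      omega
    · rw [← totalWidth_fieldGroups F width val, field_append_right, field_fieldArray hj hv]

/-! ### The layout of the tables -/

/-- The numbers from which the tables are built. -/
structure TableData where
  wide : ℕ
  narrow : ℕ
  size : ℕ
  depth : ℕ
  leaves : ℕ → ℕ
  internal : ℕ → ℕ
  start : ℕ → ℕ
  len : ℕ → ℕ
  key : ℕ → ℕ

namespace TableData

variable (D : TableData)

/-- The number of groups of keys. -/
def groups : ℕ := D.size / D.wide + 1

/-- The width of the fields of a group. -/
def groupWidth (g : ℕ) : ℕ :=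
  if D.key ((g + 1) * D.wide) - D.key (g * D.wide) < 2 ^ D.narrow then D.narrow else D.wide

/-- The entries of the header. -/
def header : ℕ → ℕ
  | 0 => D.wide
  | 1 => D.narrow
  | 2 => D.size
  | 3 => D.wide + 1 + 10 * D.wide
  | 4 => D.wide + 1 + 10 * D.wide + (D.depth + 1) * D.wide
  | 5 => D.wide + 1 + 10 * D.wide + (D.depth + 1) * D.wide + (D.depth + 1) * D.wide
  | 6 => D.wide + 1 + 10 * D.wide + (D.depth + 1) * D.wide + (D.depth + 1) * D.wide +
      (D.depth + 1) * D.wide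
  | 7 => D.wide + 1 + 10 * D.wide + (D.depth + 1) * D.wide + (D.depth + 1) * D.wide +
      (D.depth + 1) * D.wide + D.size * D.narrow
  | 8 => D.wide + 1 + 10 * D.wide + (D.depth + 1) * D.wide + (D.depth + 1) * D.wide +
      (D.depth + 1) * D.wide + D.size * D.narrow + D.groups * D.wide
  | _ => D.wide + 1 + 10 * D.wide + (D.depth + 1) * D.wide + (D.depth + 1) * D.wide +
      (D.depth + 1) * D.wide + D.size * D.narrow + D.groups * D.wide + D.groups * D.wide

/-- The tables. -/
def tables : Tables where
  depth := D.depth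
  header := D.header
  leaves := D.leaves
  internal := D.internal
  start := D.start
  len := D.len
  anchor g := D.key (g * D.wide)
  width := D.groupWidth
  pos g := D.header 9 + D.groups * D.wide + ∑ k ∈ Finset.range g, D.wide * D.groupWidth k
  key := D.key

/-- The differences of the keys to the anchors of their groups. -/
def payload : List (ℕ × ℕ) :=
  fieldGroups D.wide D.groupWidth (fun g j => D.key (g * D.wide + j) - D.key (g * D.wide)) D.groups

/-- The contents of the data memory as a list of fields. -/
def fields : List (ℕ × ℕ) :=
  [(D.wide + 1, 2 ^ D.wide - 1)] ++ (fieldArray D.wide 10 D.header ++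
  (fieldArray D.wide (D.depth + 1) D.leaves ++ (fieldArray D.wide (D.depth + 1) D.internal ++
  (fieldArray D.wide (D.depth + 1) D.start ++ (fieldArray D.narrow D.size D.len ++
  (fieldArray D.wide D.groups D.tables.anchor ++ (fieldArray D.wide D.groups D.tables.width ++
  (fieldArray D.wide D.groups D.tables.pos ++ D.payload))))))))

theorem totalWidth_fields : totalWidth D.fields = D.wide + 1 + 10 * D.wide +
    3 * ((D.depth + 1) * D.wide) + D.size * D.narrow + 3 * (D.groups * D.wide) +
    ∑ g ∈ Finset.range D.groups, D.wide * D.groupWidth g := by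
  simp only [fields, totalWidth_append, totalWidth_fieldArray, payload, totalWidth_fieldGroups]
  simp only [totalWidth, List.map_cons, List.map_nil, List.sum_cons, List.sum_nil]
  ring

variable {D}

theorem field_fieldArray_append {n k : ℕ} {f : ℕ → ℕ} {j : ℕ} (l : List (ℕ × ℕ)) (hj : j < k)
    (hf : f j < 2 ^ n) : field (fieldsNat (fieldArray n k f ++ l)) (j * n) n = f j := by
  rw [field_append_left, field_fieldArray hj hf]
  rw [totalWidth_fieldArray, ← Nat.succ_mul]
  exact Nat.mul_le_mul_right _ hj

/-- Moves the base position past one array, so that the layout can be unfolded array by array. -/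
theorem field_append_array (n k : ℕ) (f : ℕ → ℕ) (l : List (ℕ × ℕ)) (N B : ℕ)
    (h : ∀ p m, field N (B + p) m = field (fieldsNat (fieldArray n k f ++ l)) p m) (p m : ℕ) :
    field N (B + k * n + p) m = field (fieldsNat l) p m := by
  rw [add_assoc, h, ← totalWidth_fieldArray n k f, field_append_right]

/-- The bound `htotal` on the whole memory guarantees that every stored position fits into a wide
entry. -/
theorem storedIn (hwide : 0 < D.wide) (hnarrow : D.narrow ≤ D.wide)
    (htotal : totalWidth D.fields < 2 ^ D.wide) (hsize : D.size < 2 ^ D.wide)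
    (hleaves : ∀ d, D.leaves d < 2 ^ D.wide)
    (hinternal : ∀ d, D.internal d < 2 ^ D.wide) (hstart : ∀ d, D.start d < 2 ^ D.wide)
    (hlen : ∀ i < D.size, D.len i < 2 ^ D.narrow) (hkey : Monotone D.key)
    (hkeylt : ∀ P, D.key P < 2 ^ D.wide) :
    D.tables.StoredIn (bitsToNat (encodeFields D.fields)) := by
  change D.tables.StoredIn (fieldsNat D.fields)
  have htw := D.totalWidth_fields
  set N := fieldsNat D.fields with hN
  have h2 : ∀ p n, field N (D.wide + 1 + p) n = _ := fun p n =>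
    field_append_right [(D.wide + 1, 2 ^ D.wide - 1)] _ p n
  have h3 := field_append_array _ _ _ _ _ _ h2
  have h4 := field_append_array _ _ _ _ _ _ h3
  have h5 := field_append_array _ _ _ _ _ _ h4
  have h6 := field_append_array _ _ _ _ _ _ h5
  have h7 := field_append_array _ _ _ _ _ _ h6
  have h8 := field_append_array _ _ _ _ _ _ h7
  have h9 := field_append_array _ _ _ _ _ _ h8
  have h10 := field_append_array _ _ _ _ _ _ h9
  have hw1 : 1 ≤ D.wide := hwide
  have hdw : D.depth + 1 ≤ (D.depth + 1) * D.wide := Nat.le_mul_of_pos_right _ hwide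
  have hwl : D.wide < 2 ^ D.wide := Nat.lt_two_pow_self
  have hheader : ∀ j ≤ 9, D.header j < 2 ^ D.wide := by
    intro j hj
    interval_cases j <;> simp only [header] <;> omega
  have hgroup : ∀ P < D.size, P / D.wide < D.groups := fun P hP =>
    Nat.lt_succ_of_le (Nat.div_le_div_right hP.le)
  have hgw : ∀ g, D.groupWidth g ≤ D.wide := by
    intro g
    unfold groupWidth
    split_ifs <;> omega
  have hpos : ∀ g ≤ D.groups, D.tables.pos g < 2 ^ D.wide := by
    intro g hg
    have : ∑ k ∈ Finset.range g, D.wide * D.groupWidth k ≤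
        ∑ k ∈ Finset.range D.groups, D.wide * D.groupWidth k :=
      Finset.sum_le_sum_of_subset (Finset.range_mono hg)
    change D.header 9 + D.groups * D.wide + _ < _
    simp only [header]
    omega
  refine
    { wide_pos := hwide
      depth_lt := ?_
      narrow_le := hnarrow
      prelude := ?_
      header := fun j hj => (h2 _ _).trans (field_fieldArray_append _ (by omega) (hheader j hj))
      leaves := fun d hd => (h3 _ _).trans
        (field_fieldArray_append _ (Nat.lt_succ_of_le hd) (hleaves d))
      internal := fun d hd => (h4 _ _).trans
        (field_fieldArray_append _ (Nat.lt_succ_of_le hd) (hinternal d))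
      start := fun d hd => (h5 _ _).trans
        (field_fieldArray_append _ (Nat.lt_succ_of_le hd) (hstart d))
      len := fun i hi => (h6 _ _).trans (field_fieldArray_append _ hi (hlen i hi))
      anchor := fun P hP => (h7 _ _).trans (field_fieldArray_append _ (hgroup P hP) (hkeylt _))
      width := fun P hP => (h8 _ _).trans
        (field_fieldArray_append _ (hgroup P hP) ((hgw _).trans_lt hwl))
      pos := fun P hP => (h9 _ _).trans
        (field_fieldArray_append _ (hgroup P hP) (hpos _ (hgroup P hP).le))
      key := ?_
      anchor_le := fun P _ => hkey (Nat.div_mul_le_self P D.wide)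
      width_le := fun P _ => hgw _
      key_lt := fun P _ => hkeylt P }
  · change D.depth < 2 ^ D.wide
    omega
  · have h1 : field N 0 (D.wide + 1) = _ :=
      field_append_left [(D.wide + 1, 2 ^ D.wide - 1)] _ (by simp [totalWidth])
    rw [field_singleton, Nat.mod_eq_of_lt (a := 2 ^ D.wide - 1)] at h1
    · rw [field, pow_zero, Nat.div_one] at h1
      exact h1
    · rw [pow_succ]
      omega
  · intro P hP
    have hm : P % D.wide < D.wide := Nat.mod_lt _ hwide
    have hP' : P / D.wide * D.wide + P % D.wide = P := Nat.div_add_mod' P D.wide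
    have := field_fieldGroups (val := fun g j => D.key (g * D.wide + j) - D.key (g * D.wide))
      (width := D.groupWidth) (hgroup P hP) hm (by
        simp only [hP']
        unfold groupWidth
        split_ifs with h
        -- The narrow width is granted by the anchor of the next group, which bounds every key of
        -- this group.
        · refine lt_of_le_of_lt (Nat.sub_le_sub_right (hkey ?_) _) h
          rw [add_mul, one_mul]
          omega
        · exact (Nat.sub_le _ _).trans_lt (hkeylt _))
    simp only [hP'] at this
    rw [← payload, ← h10, ← add_assoc] at this
    exact this

end TableData

end WordRAM

/-! ### The order of the characters by codeword length -/

section Order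

variable {σ : ℕ} (c : Fin σ → List Bool)

/-- The number of codewords that are shorter than `d`. -/
def shorterCount (d : ℕ) : ℕ := (Finset.univ.filter fun i => (c i).length < d).card

/-- Characters are compared by codeword length first. -/
def charKey (i : Fin σ) : ℕ := (c i).length * σ + i

/-- The number of characters with smaller keys. -/
def charRank (i : Fin σ) : ℕ := (Finset.univ.filter fun j => charKey c j < charKey c i).card

variable {c}

theorem shorterCount_mono : Monotone (shorterCount c) := fun _ _ h =>
  Finset.card_le_card (Finset.monotone_filter_right _ fun _ _ h' => lt_of_lt_of_le h' h)

theorem shorterCount_le (d : ℕ) : shorterCount c d ≤ σ :=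
  (Finset.card_filter_le _ _).trans (by simp)

theorem IsPrefixCode.shorterCount_succ (hc : IsPrefixCode c) (d : ℕ) :
    shorterCount c (d + 1) = shorterCount c d + (levelLeaves c d).card := by
  rw [hc.card_levelLeaves, shorterCount, shorterCount, ← Finset.card_union_of_disjoint]
  · congr 1
    ext i
    simp
    omega
  · rw [Finset.disjoint_left]
    intro i h1 h2
    simp at h1 h2
    omega

theorem charKey_lt_of_length_lt {i j : Fin σ} (h : (c i).length < (c j).length) :
    charKey c i < charKey c j := by
  have := Nat.mul_le_mul_right σ (Nat.succ_le_of_lt h)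
  have := i.2
  rw [Nat.succ_mul] at *
  unfold charKey
  omega

theorem length_le_of_charKey_le {i j : Fin σ} (h : charKey c i ≤ charKey c j) :
    (c i).length ≤ (c j).length := by
  by_contra hn
  exact absurd (charKey_lt_of_length_lt (not_le.1 hn)) (not_lt.2 h)

theorem charKey_injective : Function.Injective (charKey c) := by
  intro i j h
  have h1 := length_le_of_charKey_le h.le
  have h2 := length_le_of_charKey_le h.ge
  unfold charKey at h
  rw [le_antisymm h1 h2] at h
  exact Fin.ext (by omega)

theorem charRank_lt_charRank {i j : Fin σ} (h : charKey c i < charKey c j) :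
    charRank c i < charRank c j := by
  refine Finset.card_lt_card ⟨fun k hk => ?_, fun h' => ?_⟩
  · rw [Finset.mem_filter] at hk ⊢
    exact ⟨hk.1, hk.2.trans h⟩
  · exact lt_irrefl _ (Finset.mem_filter.1 (h' (Finset.mem_filter.2 ⟨Finset.mem_univ _, h⟩))).2

/-- With `charRank_lt`, the ranks of the characters with codeword length `l` lie between
`shorterCount c l` and `shorterCount c (l + 1)`, the interval that also holds the positions of the
leaves of level `l`. -/
theorem shorterCount_le_charRank (i : Fin σ) : shorterCount c (c i).length ≤ charRank c i :=
  Finset.card_le_card (Finset.monotone_filter_right _ fun _ _ h => charKey_lt_of_length_lt h)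

theorem charRank_lt (i : Fin σ) : charRank c i < shorterCount c ((c i).length + 1) := by
  refine Finset.card_lt_card ⟨fun k hk => ?_, fun h' => ?_⟩
  · rw [Finset.mem_filter] at hk ⊢
    exact ⟨hk.1, Nat.lt_succ_of_le (length_le_of_charKey_le hk.2.le)⟩
  · exact lt_irrefl _ (Finset.mem_filter.1 (h' (Finset.mem_filter.2
      ⟨Finset.mem_univ i, Nat.lt_succ_self _⟩))).2

variable (c) in
/-- The bijection between the characters and their ranks. -/
noncomputable def charRankEquiv : Fin σ ≃ Fin σ :=
  Equiv.ofBijective (fun i => ⟨charRank c i, (charRank_lt i).trans_le (shorterCount_le _)⟩) <| by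
    refine Finite.injective_iff_bijective.1 fun i j h => ?_
    have h : charRank c i = charRank c j := congrArg Fin.val h
    rcases lt_trichotomy (charKey c i) (charKey c j) with h' | h' | h'
    · exact absurd h (charRank_lt_charRank h').ne
    · exact charKey_injective h'
    · exact absurd h (charRank_lt_charRank h').ne'

variable (c) in
/-- The increasing sequence of the keys, continued by a constant. -/
noncomputable def sortedKey (P : ℕ) : ℕ :=
  if h : P < σ then charKey c ((charRankEquiv c).symm ⟨P, h⟩) else (maxCodewordLength c + 1) * σ

theorem charKey_lt (i : Fin σ) : charKey c i < (maxCodewordLength c + 1) * σ := by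
  have := Nat.mul_le_mul_right σ (length_le_maxCodewordLength c i)
  have := i.2
  rw [Nat.succ_mul]
  unfold charKey
  omega

theorem sortedKey_le (P : ℕ) : sortedKey c P ≤ (maxCodewordLength c + 1) * σ := by
  unfold sortedKey
  split_ifs
  · exact (charKey_lt _).le
  · exact le_rfl

theorem sortedKey_charRank (i : Fin σ) : sortedKey c (charRank c i) = charKey c i := by
  have h : charRank c i < σ := (charRankEquiv c i).2
  rw [sortedKey, dif_pos h]
  congr 1
  rw [Equiv.symm_apply_eq]
  rfl

theorem sortedKey_strictMono {P Q : ℕ} (h : P < Q) (hQ : Q < σ) :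
    sortedKey c P < sortedKey c Q := by
  obtain ⟨i, hi⟩ := (charRankEquiv c).surjective ⟨P, h.trans hQ⟩
  obtain ⟨j, hj⟩ := (charRankEquiv c).surjective ⟨Q, hQ⟩
  obtain rfl : charRank c i = P := congrArg Fin.val hi
  obtain rfl : charRank c j = Q := congrArg Fin.val hj
  rw [sortedKey_charRank, sortedKey_charRank]
  by_contra hn
  rcases (not_lt.1 hn).eq_or_lt with h' | h'
  · rw [charKey_injective h'] at h
    omega
  · have := charRank_lt_charRank h'
    omega

theorem sortedKey_mono : Monotone (sortedKey c) := by
  intro P Q h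
  by_cases hQ : Q < σ
  · rcases h.eq_or_lt with rfl | h
    · rfl
    · exact (sortedKey_strictMono h hQ).le
  · conv_rhs => rw [sortedKey, dif_neg hQ]
    exact sortedKey_le P

theorem length_eq_of_mem_Ico {l l' P : ℕ} (h1 : shorterCount c l ≤ P)
    (h2 : P < shorterCount c (l + 1)) (h1' : shorterCount c l' ≤ P)
    (h2' : P < shorterCount c (l' + 1)) : l = l' := by
  rcases lt_trichotomy l l' with h | h | h
  · have := shorterCount_mono (c := c) (Nat.succ_le_of_lt h)
    simp only [Nat.succ_eq_add_one] at this
    omega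
  · exact h
  · have := shorterCount_mono (c := c) (Nat.succ_le_of_lt h)
    simp only [Nat.succ_eq_add_one] at this
    omega

/-- The position of a leaf when the leaves are ordered by level. -/
theorem IsCompletePrefixCode.leafPosition_lt (hc : IsCompletePrefixCode c)
    (hm : LengthsMonotoneInReverseLex c) (i : Fin σ) :
    shorterCount c (c i).length + nodeIndex c (c i) < shorterCount c ((c i).length + 1) := by
  rw [hc.prefixFree.shorterCount_succ]
  have := hc.nodeIndex_lt hm i
  omega

/-- Codewords of the same length can be permuted so that the order of the leaves of each level
becomes the order of the characters. -/
theorem IsCompletePrefixCode.exists_perm (hc : IsCompletePrefixCode c)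
    (hm : LengthsMonotoneInReverseLex c) :
    ∃ π : Equiv.Perm (Fin σ), ∀ i, (c (π i)).length = (c i).length ∧
      shorterCount c (c i).length + nodeIndex c (c (π i)) = charRank c i := by
  let f : Fin σ → Fin σ := fun i => ⟨shorterCount c (c i).length + nodeIndex c (c i),
    (hc.leafPosition_lt hm i).trans_le (shorterCount_le _)⟩
  have hf : Function.Injective f := by
    intro i j h
    have h : shorterCount c (c i).length + nodeIndex c (c i) =
      shorterCount c (c j).length + nodeIndex c (c j) := congrArg Fin.val h
    have hl : (c i).length = (c j).length := length_eq_of_mem_Ico (Nat.le_add_right _ _)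
      (hc.leafPosition_lt hm i) (h ▸ Nat.le_add_right _ _) (h ▸ hc.leafPosition_lt hm j)
    rw [hl] at h
    exact hc.prefixFree.eq_of_nodeIndex_eq hl (Nat.add_left_cancel h)
  -- Leaf positions and character ranks are both bijections onto `Fin σ`; the permutation sends a
  -- character to the one whose leaf position is its rank. The intervals of the levels are disjoint,
  -- so lengths are preserved.
  let e := Equiv.ofBijective f (Finite.injective_iff_bijective.1 hf)
  refine ⟨(charRankEquiv c).trans e.symm, fun i => ?_⟩
  set j := ((charRankEquiv c).trans e.symm) i with hj
  have h1 : e j = charRankEquiv c i := by simp [hj]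
  have h2 : shorterCount c (c j).length + nodeIndex c (c j) = charRank c i := congrArg Fin.val h1
  have hl : (c j).length = (c i).length := length_eq_of_mem_Ico (Nat.le_add_right _ _)
    (hc.leafPosition_lt hm j) (h2 ▸ shorterCount_le_charRank i) (h2 ▸ charRank_lt i)
  exact ⟨hl, hl ▸ h2⟩

end Order

/-! ### The tables of a code -/

namespace WordRAM

open Tables

section CodeData

variable {σ : ℕ} (c : Fin σ → List Bool)

/-- The numbers that are stored for the code `c`. -/
noncomputable def codeData : TableData where
  wide := 16 * Nat.size σ
  narrow := 8 + 3 * Nat.size (maxCodewordLength c + 1)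
  size := σ
  depth := maxCodewordLength c
  leaves d := (levelLeaves c d).card
  internal d := (levelInternal c d).card
  start := shorterCount c
  len i := if h : i < σ then (c ⟨i, h⟩).length else 0
  key := sortedKey c

variable {c}

/-- Here `j` is the image of `i` under the permutation: the character `i` receives the codeword `c
j`, whose leaf sits at the rank of `i`. -/
theorem isCodeword_codeData (hσ : 2 ≤ σ) (hc : IsCompletePrefixCode c)
    (hm : LengthsMonotoneInReverseLex c) {i j : Fin σ} (hl : (c j).length = (c i).length)
    (hij : shorterCount c (c i).length + nodeIndex c (c j) = charRank c i) :
    (codeData c).tables.IsCodeword i (c j) fun d => nodeIndex c ((c j).take d) := by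
  have hint : ∀ d < (c j).length, (c j).take d ∈ levelInternal c d := fun d hd =>
    mem_levelInternal.2 ⟨j, hd, rfl⟩
  have hidx : ∀ d < (c j).length, nodeIndex c ((c j).take d) - (levelLeaves c d).card =
      ((levelInternal c d).filter fun u => u.reverse < ((c j).take d).reverse).card :=
    fun d hd => by rw [hc.nodeIndex_internal hm (hint d hd), Nat.add_sub_cancel_left]
  refine
    { lt_size := i.2
      len_eq := ?_
      length_pos := hc.prefixFree.length_pos hσ j
      length_le := length_le_maxCodewordLength c j
      x_zero := by simp [nodeIndex_nil]
      leaves_le := fun d hd => ?_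
      sub_lt := fun d hd => ?_
      x_succ := fun d hd => ?_
      x_last := ?_
      start_add_le := ?_
      key_eq := ?_
      key_strictMono := fun P Q h hQ => sortedKey_strictMono h hQ
      leaves_le_two_pow := card_levelLeaves_le_two_pow _ }
  · simp [codeData, TableData.tables, hl]
  · exact (hc.nodeIndex_internal hm (hint d hd)).symm ▸ Nat.le_add_right _ _
  · exact (hidx d hd).trans_lt (card_filter_internal_lt (hint d hd))
  · change nodeIndex c ((c j).take (d + 1)) = nodeIndex c ((c j).take d) -
      (levelLeaves c d).card + _ * (levelInternal c d).card
    rw [hidx d hd, List.take_succ_eq_append_getElem hd, hc.nodeIndex_child (hint d hd)]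
  · change nodeIndex c _ < (levelLeaves c _).card
    rw [List.take_length]
    exact hc.nodeIndex_lt hm j
  · change shorterCount c _ + (levelLeaves c _).card ≤ σ
    rw [← hc.prefixFree.shorterCount_succ]
    exact shorterCount_le _
  · change sortedKey c (shorterCount c _ + nodeIndex c _) = (c j).length * σ + i
    rw [List.take_length, hl, hij, sortedKey_charRank]
    rfl

/-! ### The size of the tables -/

theorem sq_le_four_mul_two_pow (n : ℕ) : n ^ 2 ≤ 4 * 2 ^ n := by
  induction n with
  | zero => norm_num
  | succ n ih =>
    rcases Nat.lt_or_ge n 3 with h | h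
    · interval_cases n <;> norm_num
    · rw [pow_succ 2 n]
      nlinarith

/-- If `σ ≤ M ^ 2`, the logarithms of `σ` and `M` agree up to a factor. Otherwise `M` is below `√σ`,
and `√σ log σ = O(σ)`. With `M = L + 1` this bounds the tables indexed by levels. -/
theorem mul_size_le {σ M : ℕ} (hσ : 2 ≤ σ) (hM : M ≤ σ + 1) (hM0 : 0 < M) :
    M * Nat.size σ ≤ 4 * (σ * Nat.size M) := by
  have hs : 0 < Nat.size M := Nat.size_pos.2 hM0
  rcases le_or_gt σ (M ^ 2) with h | h
  · have h1 : Nat.size σ ≤ 2 * Nat.size M := by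
      rw [Nat.size_le, mul_comm, pow_mul]
      exact h.trans_lt (Nat.pow_lt_pow_left (Nat.lt_size_self M) (by norm_num))
    calc M * Nat.size σ ≤ (2 * σ) * (2 * Nat.size M) := Nat.mul_le_mul (by omega) h1
      _ = _ := by ring
  · have h1 : Nat.size σ ^ 2 ≤ 8 * σ := by
      have h2 : 2 ^ (Nat.size σ - 1) ≤ σ := Nat.lt_size.1 (by
        have := Nat.size_pos.2 (show 0 < σ by omega)
        omega)
      have h3 : 2 ^ Nat.size σ = 2 * 2 ^ (Nat.size σ - 1) := by
        rw [← pow_succ', Nat.sub_add_cancel (Nat.size_pos.2 (by omega))]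
      have := sq_le_four_mul_two_pow (Nat.size σ)
      omega
    have h2 : M * Nat.size σ ≤ 4 * σ := by
      apply (Nat.pow_le_pow_iff_left (n := 2) (by norm_num)).1
      calc (M * Nat.size σ) ^ 2 = M ^ 2 * Nat.size σ ^ 2 := by ring
        _ ≤ σ * (8 * σ) := Nat.mul_le_mul h.le h1
        _ ≤ (4 * σ) ^ 2 := by nlinarith
    calc M * Nat.size σ ≤ 4 * σ := h2
      _ ≤ 4 * (σ * Nat.size M) := by nlinarith [Nat.le_mul_of_pos_right σ hs]

/-- An amortization: the keys of a wide group increase by at least `2 ^ narrow`, which is at least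
`L + 1` times the bits the group occupies. The increases telescope to at most `(L + 1) * σ`, so all
wide groups together occupy at most `σ` bits. -/
theorem sum_groupWidth_le (hc : IsPrefixCode c) :
    ∑ g ∈ Finset.range (codeData c).groups, (codeData c).wide * (codeData c).groupWidth g ≤
      (codeData c).groups * ((codeData c).wide * (codeData c).narrow) + σ := by
  set D := codeData c with hD
  set L := maxCodewordLength c with hL
  have hsize : Nat.size σ ≤ L + 1 :=
    Nat.size_le.2 (hc.card_le.trans_lt (Nat.pow_lt_pow_right (by norm_num) (by omega)))
  -- This fixes the narrow width: `3` for the three factors of order `L + 1` (using `Nat.size σ ≤ L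
  -- + 1`), and `8` for `16 ^ 2`.
  have hpow : (L + 1) * (D.wide * D.wide) ≤ 2 ^ D.narrow := by
    have h1 : L + 1 ≤ 2 ^ Nat.size (L + 1) := (Nat.lt_size_self _).le
    have h2 : 2 ^ D.narrow = 256 * (2 ^ Nat.size (L + 1)) ^ 3 := by
      change 2 ^ (8 + 3 * Nat.size (L + 1)) = _
      rw [pow_add, mul_comm 3, pow_mul]
      norm_num
    calc (L + 1) * (D.wide * D.wide) = 256 * ((L + 1) * (Nat.size σ * Nat.size σ)) := by
          change (L + 1) * (16 * Nat.size σ * (16 * Nat.size σ)) = _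
          ring
      _ ≤ 256 * ((L + 1) * ((L + 1) * (L + 1))) := by gcongr
      _ = 256 * (L + 1) ^ 3 := by ring
      _ ≤ 256 * (2 ^ Nat.size (L + 1)) ^ 3 := by gcongr
      _ = 2 ^ D.narrow := h2.symm
  have hmono : Monotone fun g => D.key (g * D.wide) := fun a b h =>
    sortedKey_mono (Nat.mul_le_mul_right _ h)
  have hterm : ∀ g ∈ Finset.range D.groups, (L + 1) * (D.wide * D.groupWidth g) ≤
      (L + 1) * (D.wide * D.narrow) + (D.key ((g + 1) * D.wide) - D.key (g * D.wide)) := by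
    intro g _
    unfold TableData.groupWidth
    split_ifs with h
    · exact Nat.le_add_right _ _
    · omega
  have hsum := Finset.sum_le_sum hterm
  rw [Finset.sum_add_distrib, Finset.sum_const, Finset.card_range, smul_eq_mul,
    Finset.sum_range_tsub hmono, ← Finset.mul_sum] at hsum
  have hlast : D.key (D.groups * D.wide) ≤ (L + 1) * σ := sortedKey_le _
  refine Nat.le_of_mul_le_mul_left (c := L + 1) ?_ (by omega)
  calc _ ≤ _ := hsum
    _ ≤ D.groups * ((L + 1) * (D.wide * D.narrow)) + (L + 1) * σ := by omega
    _ = _ := by ring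

theorem totalWidth_codeData_le (hσ : 2 ≤ σ) (hc : IsCompletePrefixCode c) :
    totalWidth (codeData c).fields ≤ 1024 * (σ * Nat.size (maxCodewordLength c + 1)) := by
  have h1 := sum_groupWidth_le hc.prefixFree
  rw [TableData.totalWidth_fields]
  have hL := hc.maxCodewordLength_le
  have h2 := mul_size_le hσ (M := maxCodewordLength c + 1) (by omega) (by omega)
  have hs : 0 < Nat.size (maxCodewordLength c + 1) := Nat.size_pos.2 (by omega)
  have hn : Nat.size σ ≤ σ := Nat.size_le.2 Nat.lt_two_pow_self
  have hgroups : (codeData c).groups * (codeData c).wide ≤ σ + 16 * Nat.size σ := by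
    change (σ / (16 * Nat.size σ) + 1) * (16 * Nat.size σ) ≤ _
    rw [add_mul, one_mul]
    exact Nat.add_le_add_right (Nat.div_mul_le_self _ _) _
  have h3 : (codeData c).groups * ((codeData c).wide * (codeData c).narrow) ≤
      17 * σ * (11 * Nat.size (maxCodewordLength c + 1)) := by
    rw [← mul_assoc]
    refine Nat.mul_le_mul (hgroups.trans (by omega)) ?_
    change 8 + 3 * Nat.size (maxCodewordLength c + 1) ≤ _
    omega
  change 16 * Nat.size σ + 1 + 10 * (16 * Nat.size σ) +
    3 * ((maxCodewordLength c + 1) * (16 * Nat.size σ)) +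
    σ * (8 + 3 * Nat.size (maxCodewordLength c + 1)) +
    3 * ((codeData c).groups * (codeData c).wide) + _ ≤ _
  generalize (codeData c).groups * (codeData c).wide = G at *
  generalize (codeData c).groups * ((codeData c).wide * (codeData c).narrow) = G' at *
  generalize Nat.size (maxCodewordLength c + 1) = s at *
  have h4 : σ ≤ σ * s := Nat.le_mul_of_pos_right _ hs
  have h5 : (maxCodewordLength c + 1) * (16 * Nat.size σ) =
    16 * ((maxCodewordLength c + 1) * Nat.size σ) := by ring
  have h6 : σ * (8 + 3 * s) = 8 * σ + 3 * (σ * s) := by ring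
  have h7 : 17 * σ * (11 * s) = 187 * (σ * s) := by ring
  rw [h5, h6]
  omega

/-- The factor `16` in the wide width makes room for the narrow width and for positions, which are
below `2 ^ (10 + 2 * Nat.size σ)`. -/
theorem storedIn_codeData (hσ : 2 ≤ σ) (hc : IsCompletePrefixCode c) :
    (codeData c).tables.StoredIn (bitsToNat (encodeFields (codeData c).fields)) := by
  have hL := hc.maxCodewordLength_le
  have hn : 0 < Nat.size σ := Nat.size_pos.2 (by omega)
  have hσn : σ < 2 ^ Nat.size σ := Nat.lt_size_self σ
  have hs : Nat.size (maxCodewordLength c + 1) ≤ Nat.size σ + 1 := by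
    rw [Nat.size_le, pow_succ]
    omega
  have hpow : ∀ k, k ≤ 16 * Nat.size σ → 2 ^ k ≤ 2 ^ (16 * Nat.size σ) := fun k hk =>
    Nat.pow_le_pow_right (by norm_num) hk
  have hσF : σ < 2 ^ (16 * Nat.size σ) := hσn.trans_le (hpow _ (by omega))
  apply TableData.storedIn
  · change 0 < 16 * Nat.size σ
    omega
  · change 8 + 3 * Nat.size (maxCodewordLength c + 1) ≤ 16 * Nat.size σ
    omega
  · refine (totalWidth_codeData_le hσ hc).trans_lt ?_
    change _ < 2 ^ (16 * Nat.size σ)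
    refine lt_of_lt_of_le ?_ (hpow (10 + (Nat.size σ + Nat.size σ)) (by omega))
    rw [pow_add, pow_add]
    have h1 : Nat.size σ + 1 ≤ 2 ^ Nat.size σ := Nat.lt_two_pow_self
    have h2 : σ * Nat.size (maxCodewordLength c + 1) < 2 ^ Nat.size σ * 2 ^ Nat.size σ :=
      Nat.mul_lt_mul_of_lt_of_le hσn (hs.trans h1) (by positivity)
    omega
  · exact hσF
  · exact fun d => (card_levelLeaves_le d).trans_lt hσF
  · exact fun d => (card_levelInternal_le d).trans_lt hσF
  · exact fun d => (shorterCount_le d).trans_lt hσF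
  · intro i hi
    have hi : i < σ := hi
    change (if h : i < σ then (c ⟨i, h⟩).length else 0) <
      2 ^ (8 + 3 * Nat.size (maxCodewordLength c + 1))
    rw [dif_pos hi]
    calc (c ⟨i, hi⟩).length < maxCodewordLength c + 1 :=
          Nat.lt_succ_of_le (length_le_maxCodewordLength c _)
      _ < 2 ^ Nat.size (maxCodewordLength c + 1) := Nat.lt_size_self _
      _ ≤ _ := Nat.pow_le_pow_right (by norm_num) (by omega)
  · exact sortedKey_mono
  · intro P
    refine (sortedKey_le P).trans_lt ?_
    change _ < 2 ^ (16 * Nat.size σ)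
    refine lt_of_lt_of_le ?_ (hpow (Nat.size σ + Nat.size σ + 1) (by omega))
    rw [pow_succ, pow_add]
    nlinarith

end CodeData

/-- The size is at most `2` plus the logarithm of `max L 2`, and that logarithm is at least `1`. -/
theorem size_succ_le_logb (L : ℕ) : (Nat.size (L + 1) : ℝ) ≤ 3 * Real.logb 2 (max (L : ℝ) 2) := by
  have hs : 0 < Nat.size (L + 1) := Nat.size_pos.2 (by omega)
  have h1 : 2 ^ (Nat.size (L + 1) - 1) ≤ L + 1 := Nat.lt_size.1 (by omega)
  have h2 : (2 : ℝ) ^ (Nat.size (L + 1) - 1) ≤ 2 * max (L : ℝ) 2 := by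
    have h3 : (2 : ℝ) ^ (Nat.size (L + 1) - 1) ≤ L + 1 := by exact_mod_cast h1
    have h4 := le_max_left (L : ℝ) 2
    have h5 := le_max_right (L : ℝ) 2
    linarith
  have hpos : (0 : ℝ) < max (L : ℝ) 2 := lt_max_of_lt_right two_pos
  have h3 : ((Nat.size (L + 1) - 1 : ℕ) : ℝ) ≤ Real.logb 2 (2 * max (L : ℝ) 2) := by
    rw [Real.le_logb_iff_rpow_le (by norm_num) (by positivity), Real.rpow_natCast]
    exact h2
  rw [Real.logb_mul (by norm_num) hpos.ne', Real.logb_self_eq_one (by norm_num),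
    Nat.cast_sub hs, Nat.cast_one] at h3
  have h4 : 1 ≤ Real.logb 2 (max (L : ℝ) 2) := by
    rw [Real.le_logb_iff_rpow_le (by norm_num) hpos, Real.rpow_one]
    exact le_max_right _ _
  linarith

/-- The factor `2` covers the rounding: `n ≤ 2 * (n - 1)` for `n = Nat.size σ ≥ 2`. -/
theorem mul_size_le_of_pow_le {σ κ w : ℕ} (hσ : 2 ≤ σ) (h : σ ^ (2 * κ) ≤ 2 ^ w) :
    κ * Nat.size σ ≤ w := by
  have hn : 2 ≤ Nat.size σ := Nat.lt_size.2 (by simpa using hσ)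
  have h1 : 2 ^ (Nat.size σ - 1) ≤ σ := Nat.lt_size.1 (by omega)
  have h2 : 2 ^ ((Nat.size σ - 1) * (2 * κ)) ≤ 2 ^ w := by
    rw [pow_mul]
    exact (Nat.pow_le_pow_left h1 _).trans h
  have h3 := (Nat.pow_le_pow_iff_right (by norm_num)).1 h2
  refine le_trans ?_ h3
  obtain ⟨k, hk⟩ := Nat.exists_eq_add_of_le hn
  rw [hk, show 2 + k - 1 = k + 1 by omega]
  nlinarith

end WordRAM

theorem theorem2 :
    -- one encoder, one decoder and absolute constants for all alphabets and codes
    ∃ (enc dec : WordRAM.Prog) (Cspace Ctime κ : ℕ),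
      ∀ (σ : ℕ), 2 ≤ σ →
      ∀ (p : Fin σ → ℝ), (∀ i, 0 < p i) → ∑ i, p i = 1 →
      ∀ (c : Fin σ → List Bool), IsOptimalPrefixCode p c → LengthsMonotoneInReverseLex c →
      -- the code that is stored: `c` with codewords of equal length permuted
      ∃ π : Equiv.Perm (Fin σ), (∀ i, (c (π i)).length = (c i).length) ∧
        -- any word length `w ≥ κ log₂ σ`
        ∀ (w : ℕ), σ ^ κ ≤ 2 ^ w →
          ∃ data : List Bool,
            (data.length : ℝ) ≤
              Cspace * (σ * Real.logb 2 (max (maxCodewordLength c : ℝ) 2)) ∧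
            ∀ i : Fin σ,
              WordRAM.EncodesWithin w data enc i (c (π i)) (Ctime * (c (π i)).length) ∧
              WordRAM.DecodesWithin w data dec i (c (π i)) (Ctime * (c (π i)).length) := by
  -- `3072 = 1024 * 3` combines `totalWidth_codeData_le` with `size_succ_le_logb`. `74 = 4 * 16 +
  -- 10` gives the programs the required `4 * wide + 10` bits per word.
  refine ⟨WordRAM.encoder, WordRAM.decoder, 3072, 400, 2 * 74, ?_⟩
  intro σ hσ p hp _ c hopt hm
  have hc : IsCompletePrefixCode c := ⟨hopt.1, hopt.exists_comparable (by omega) hp⟩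
  obtain ⟨π, hπ⟩ := hc.exists_perm hm
  refine ⟨π, fun i => (hπ i).1, fun w hw => ?_⟩
  refine ⟨WordRAM.encodeFields (WordRAM.codeData c).fields, ?_, fun i => ?_⟩
  · rw [WordRAM.length_encodeFields]
    have h1 : (WordRAM.totalWidth (WordRAM.codeData c).fields : ℝ) ≤
        1024 * (σ * (Nat.size (maxCodewordLength c + 1) : ℝ)) := by
      exact_mod_cast WordRAM.totalWidth_codeData_le hσ hc
    have h2 := WordRAM.size_succ_le_logb (maxCodewordLength c)
    calc _ ≤ _ := h1
      _ ≤ 1024 * (σ * (3 * Real.logb 2 (max (maxCodewordLength c : ℝ) 2))) := by gcongr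
      _ = _ := by push_cast; ring
  · have hst := WordRAM.storedIn_codeData hσ hc
    have hcw := WordRAM.isCodeword_codeData hσ hc hm (hπ i).1 (hπ i).2
    have hwide : 4 * (WordRAM.codeData c).tables.wide + 10 ≤ w := by
      have h1 := WordRAM.mul_size_le_of_pow_le hσ hw
      have h2 : 0 < Nat.size σ := Nat.size_pos.2 (by omega)
      change 4 * (16 * Nat.size σ) + 10 ≤ w
      omega
    exact ⟨WordRAM.encoder_spec hst hwide hcw, WordRAM.decoder_spec hst hwide hcw⟩
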